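/- Let $p(n)$ denote the number of partitions of $n$ (with $p(0)=1$). For $n\ge 1$ let a partition $\lambda$ of $n$ be chosen uniformly at random among all $p(n)$ partitions of $n$, and let $M_n=M_n(\lambda)$ be the multiplicity of the largest part of $\lambda$, i.e. the number of parts of $\lambda$ equal to its largest part. Then for every $n\ge 1$, $$\mathbb{P}(M_n=1)=\frac{p(n-1)}{p(n)}.$$ Moreover, with $c=\pi/\sqrt{6}$, as $n\to\infty$, $$\mathbb{P}(M_n=1)=1-\frac{c}{\sqrt{n}}+\frac{1+c^2/2}{n}+O(n^{-3/2}).$$ -/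

import Mathlib

open Filter Asymptotics MeasureTheory ProbabilityTheory

namespace RandomPartition

/-- The number `p(n)` of partitions of `n` (so `p(0) = 1`). -/
def numPartitions (n : ℕ) : ℕ := Fintype.card n.Partition

/-- Every set of partitions of `n` is an event. -/
instance instMeasurableSpacePartition (n : ℕ) : MeasurableSpace n.Partition := ⊤

instance instDiscreteMeasurableSpacePartition (n : ℕ) :
    DiscreteMeasurableSpace n.Partition := ⟨fun _ => trivial⟩

/-- The uniform probability measure on the set of partitions of `n`. -/
noncomputable def uniformMeasure (n : ℕ) : Measure n.Partition :=
  uniformOn Set.univ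

/-- The largest part size `L_n` of a partition of `n` (it is `0` for the empty partition). -/
def largestPart {n : ℕ} (lam : n.Partition) : ℕ := lam.parts.sup

/-- The multiplicity `M_n` of the largest part of a partition of `n`. -/
def largestPartMult {n : ℕ} (lam : n.Partition) : ℕ := lam.parts.count (largestPart lam)

end RandomPartition

/-!
Enlarging one copy of the largest part of a partition of `n - 1` by `1` gives a partition of `n`
whose largest part is simple, and every such partition arises exactly once
(`incrLargest_injective`, `range_incrLargest`). Hence the probability is `p(n - 1) / p(n)`, and the
expansion is a statement about the partition numbers.

It follows from the leading term of the Hardy–Ramanujan formula, with an exponentially small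
relative error: for `N = π √((n - 1/24) / 6)`,
`p(n) = κ (1 - 1 / (2 N)) N⁻² exp (2 N) + O(exp ((2 - 1/64) N))`
(`exists_abs_numPartitions_sub_le`). The constant `κ > 0` cancels in the ratio, and since
`2 (N_n - N_{n-1}) = c / √n + O(n ^ (-3/2))` and `(N_n / N_{n-1}) ^ 2 = 1 + 1 / n + O(n ^ (-2))`, the
expansion of the ratio results from expanding elementary functions.

The formula is proved by the circle method. The generating function `P(q) = ∑ p(n) q ^ n` is the
inverse of the Euler product, so the transformation of the Dedekind eta function under `τ ↦ -1 / τ`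
gives
`P(e^{-z}) = √(z / 2π) exp (π² / (6 z) - z / 24) P(e^{-4π² / z})` for `Re z > 0`
(`partitionSeries_modular`). In the Cauchy integral for `p(n)` over `z = x + i θ`, `|θ| ≤ π`, the
abscissa is the saddle point `x = π² / (6 N)`. For `|θ| ≤ 13 x` the last factor is `1` up to an
exponentially small error. For `|θ| ≥ 13 x` the factors of the Euler product with index at most
`1 / x` already make `P` exponentially smaller than on the real axis
(`norm_partitionSeries_minor`).

With `z = x ζ` there remains the integral of `√ζ exp (N (ζ + 1 / ζ))` over `1 ± 13 i`. No
saddle point approximation is needed: the integrand has an explicit primitive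
(`hasDerivAt_saddlePrimitive`) built from the entire primitive `Φ` of `exp (w ^ 2)` at
`w = √N (√ζ ∓ 1 / √ζ)`, because `w ^ 2 = N (ζ + 1 / ζ ∓ 2)` and `√ζ exp (N (ζ + 1 / ζ))` is, up to
an exact derivative, a combination of the differentials of these two functions. At the endpoints
`Φ` is `± i √π / 2` up to a Gaussian error for the first choice of `w`, and negligible for the
second.
-/

namespace RandomPartition

/-! ### The largest part and the ratio of partition numbers -/

theorem le_largestPart {n : ℕ} (lam : n.Partition) {a : ℕ} (ha : a ∈ lam.parts) :
    a ≤ largestPart lam :=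
  Multiset.le_sup ha

theorem largestPart_mem {n : ℕ} (hn : 1 ≤ n) (lam : n.Partition) :
    largestPart lam ∈ lam.parts := by
  have h : lam.parts ≠ 0 := by
    intro h
    have := lam.parts_sum
    simp [h] at this
    omega
  obtain ⟨a, ha, hmax⟩ := lam.parts.toFinset.exists_max_image id
    (by rwa [Multiset.toFinset_nonempty])
  have : largestPart lam = a :=
    le_antisymm (Multiset.sup_le.2 fun b hb => hmax b (by simpa using hb))
      (le_largestPart lam (by simpa using ha))
  rw [this]
  simpa using ha

theorem largestPart_add_sum_erase {n : ℕ} (lam : n.Partition) :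
    largestPart lam + (lam.parts.erase (largestPart lam)).sum = n := by
  rcases Nat.eq_zero_or_pos n with rfl | hn
  · simp [largestPart]
  · rw [← Multiset.sum_cons, Multiset.cons_erase (largestPart_mem hn lam), lam.parts_sum]

/-- The partition of `n + 1` obtained by enlarging one copy of the largest part by `1`; the empty
partition becomes `{1}`. -/
def incrLargest {n : ℕ} (lam : n.Partition) : (n + 1).Partition where
  parts := (largestPart lam + 1) ::ₘ lam.parts.erase (largestPart lam)
  parts_pos := by
    intro i hi
    rcases Multiset.mem_cons.1 hi with rfl | hi
    · omega
    · exact lam.parts_pos (Multiset.mem_of_mem_erase hi)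
  parts_sum := by
    have := largestPart_add_sum_erase lam
    rw [Multiset.sum_cons]
    omega

theorem largestPart_incrLargest {n : ℕ} (lam : n.Partition) :
    largestPart (incrLargest lam) = largestPart lam + 1 := by
  refine le_antisymm (Multiset.sup_le.2 fun b hb => ?_)
    (le_largestPart _ (Multiset.mem_cons_self _ _))
  rcases Multiset.mem_cons.1 hb with rfl | hb
  · exact le_rfl
  · exact (le_largestPart lam (Multiset.mem_of_mem_erase hb)).trans (Nat.le_succ _)

theorem largestPartMult_incrLargest {n : ℕ} (lam : n.Partition) :
    largestPartMult (incrLargest lam) = 1 := by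
  rw [largestPartMult, largestPart_incrLargest, incrLargest, Multiset.count_cons_self,
    Multiset.count_eq_zero_of_notMem]
  intro h
  have := le_largestPart lam (Multiset.mem_of_mem_erase h)
  omega

theorem incrLargest_injective (n : ℕ) :
    Function.Injective (incrLargest : n.Partition → (n + 1).Partition) := by
  intro lam mu h
  have hL : largestPart lam = largestPart mu := by
    have := congrArg largestPart h
    simpa [largestPart_incrLargest] using this
  have he : lam.parts.erase (largestPart lam) = mu.parts.erase (largestPart mu) := by
    have := congrArg Nat.Partition.parts h
    simpa [incrLargest, hL] using this
  rcases Nat.eq_zero_or_pos n with rfl | hn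
  · exact Subsingleton.elim _ _
  · ext1
    rw [← Multiset.cons_erase (largestPart_mem hn lam), he, hL,
      Multiset.cons_erase (largestPart_mem hn mu)]

theorem range_incrLargest (n : ℕ) :
    Set.range (incrLargest : n.Partition → (n + 1).Partition) =
      {mu | largestPartMult mu = 1} := by
  ext mu
  refine ⟨?_, fun h => ?_⟩
  · rintro ⟨lam, rfl⟩
    exact largestPartMult_incrLargest lam
  have hmem := largestPart_mem (Nat.succ_pos n) mu
  obtain ⟨L, hL⟩ : ∃ L, largestPart mu = L + 1 :=
    Nat.exists_eq_succ_of_ne_zero (mu.parts_pos hmem).ne'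
  set r := mu.parts.erase (L + 1) with hr
  have hcons : (L + 1) ::ₘ r = mu.parts := Multiset.cons_erase (hL ▸ hmem)
  have hlt : ∀ a ∈ r, a ≤ L := by
    intro a ha
    have h1 : a ≤ L + 1 := hL ▸ le_largestPart mu (Multiset.mem_of_mem_erase ha)
    have h2 : a ≠ L + 1 := by
      rintro rfl
      have h3 : r.count (L + 1) = 0 := by
        have h4 : mu.parts.count (L + 1) = 1 := by rw [← hL]; exact h
        rw [hr, Multiset.count_erase_self, h4]
      exact (Multiset.count_ne_zero.2 ha) h3
    omega
  have hsum : L + r.sum = n := by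
    have := mu.parts_sum
    rw [← hcons, Multiset.sum_cons] at this
    omega
  -- A decremented part equal to `0` has to be dropped.
  rcases Nat.eq_zero_or_pos L with rfl | hLpos
  · have hr0 : r = 0 := Multiset.eq_zero_of_forall_notMem fun a ha => by
      have := mu.parts_pos (Multiset.mem_of_mem_erase ha)
      have := hlt a ha
      omega
    have hn : n = 0 := by rw [← hsum, hr0]; rfl
    subst hn
    refine ⟨default, Nat.Partition.ext ?_⟩
    rw [← hcons, hr0]
    simp [incrLargest, largestPart]
  · let lam : n.Partition := ⟨L ::ₘ r, by
      intro i hi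
      rcases Multiset.mem_cons.1 hi with rfl | hi
      · exact hLpos
      · exact mu.parts_pos (Multiset.mem_of_mem_erase hi), by rw [Multiset.sum_cons, hsum]⟩
    have hlam : largestPart lam = L :=
      le_antisymm (Multiset.sup_le.2 fun b hb => by
        rcases Multiset.mem_cons.1 hb with rfl | hb
        · exact le_rfl
        · exact hlt b hb) (le_largestPart lam (Multiset.mem_cons_self _ _))
    refine ⟨lam, Nat.Partition.ext ?_⟩
    change (largestPart lam + 1) ::ₘ lam.parts.erase (largestPart lam) = mu.parts
    rw [hlam, ← hcons]
    simp [lam]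

theorem uniformMeasure_largestPartMult_eq_one (n : ℕ) (hn : 1 ≤ n) :
    (uniformMeasure n).real {lam | largestPartMult lam = 1} =
      (numPartitions (n - 1) : ℝ) / (numPartitions n : ℝ) := by
  obtain ⟨m, rfl⟩ := Nat.exists_eq_add_of_le' hn
  rw [← range_incrLargest, Nat.add_sub_cancel, measureReal_def, uniformMeasure,
    uniformOn_univ, Measure.count_apply (MeasurableSet.of_discrete),
    ← Set.image_univ, (incrLargest_injective m).encard_image]
  simp [numPartitions, ENat.card_eq_coe_fintype_card]

/-! ### The generating function of the partition numbers -/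

/-- The formal series `1 / (1 - X ^ (i + 1)) = ∑ j, X ^ ((i + 1) * j)`. -/
noncomputable def partSeries (i : ℕ) : PowerSeries ℝ :=
  PowerSeries.mk fun n => if (i + 1) ∣ n then 1 else 0

/-- The `n`-th coefficient of `∏ i < N, 1 / (1 - X ^ (i + 1))`, which is the number of partitions
of `n` into parts of size at most `N`. -/
noncomputable def boundedCoeff (N n : ℕ) : ℝ :=
  PowerSeries.coeff n (∏ i ∈ Finset.range N, partSeries i)

theorem tsum_X_pow_mul (i : ℕ) :
    letI : TopologicalSpace (PowerSeries ℝ) := PowerSeries.WithPiTopology.instTopologicalSpace ℝ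
    (∑' j : ℕ, (PowerSeries.X : PowerSeries ℝ) ^ ((i + 1) * j)) = partSeries i := by
  let : TopologicalSpace (PowerSeries ℝ) := PowerSeries.WithPiTopology.instTopologicalSpace ℝ
  have : T2Space (PowerSeries ℝ) := PowerSeries.WithPiTopology.instT2Space ℝ
  refine HasSum.tsum_eq ?_
  rw [PowerSeries.WithPiTopology.hasSum_iff_hasSum_coeff]
  intro d
  simp only [PowerSeries.coeff_X_pow, partSeries, PowerSeries.coeff_mk]
  by_cases hd : (i + 1) ∣ d
  · obtain ⟨k, rfl⟩ := hd
    rw [if_pos (Dvd.intro _ rfl)]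
    have h : (fun j => if (i + 1) * k = (i + 1) * j then (1 : ℝ) else 0) =
        fun j => if j = k then 1 else 0 := by
      funext j
      simp [eq_comm]
    rw [h]
    exact hasSum_ite_eq k 1
  · rw [if_neg hd]
    convert hasSum_zero using 2 with j
    rw [if_neg]
    rintro rfl
    exact hd (Dvd.intro _ rfl)

theorem tendsto_boundedCoeff (n : ℕ) :
    Tendsto (fun N => boundedCoeff N n) atTop (nhds (numPartitions n : ℝ)) := by
  let : TopologicalSpace (PowerSeries ℝ) := PowerSeries.WithPiTopology.instTopologicalSpace ℝ
  have h := Nat.Partition.hasProd_powerSeriesMk_card_restricted ℝ (fun _ => True)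
  simp only [if_true, tsum_X_pow_mul] at h
  have h2 := h.tendsto_prod_nat
  rw [PowerSeries.WithPiTopology.tendsto_iff_coeff_tendsto] at h2
  have h3 := h2 n
  simpa [boundedCoeff, Nat.Partition.restricted, numPartitions] using h3

theorem partSeries_coeff_nonneg (i n : ℕ) : 0 ≤ PowerSeries.coeff n (partSeries i) := by
  rw [partSeries, PowerSeries.coeff_mk]
  split_ifs <;> norm_num

theorem boundedCoeff_nonneg (N n : ℕ) : 0 ≤ boundedCoeff N n := by
  induction N generalizing n with
  | zero =>
    simp only [boundedCoeff, Finset.range_zero, Finset.prod_empty, PowerSeries.coeff_one]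
    split_ifs <;> norm_num
  | succ N ih =>
    rw [boundedCoeff, Finset.prod_range_succ, PowerSeries.coeff_mul]
    exact Finset.sum_nonneg fun p _ => mul_nonneg (ih _) (partSeries_coeff_nonneg _ _)

theorem boundedCoeff_mono (n : ℕ) : Monotone fun N => boundedCoeff N n := by
  refine monotone_nat_of_le_succ fun N => ?_
  simp only [boundedCoeff]
  rw [Finset.prod_range_succ, PowerSeries.coeff_mul]
  have h0 : PowerSeries.coeff 0 (partSeries N) = 1 := by simp [partSeries]
  have := Finset.single_le_sum
    (f := fun p : ℕ × ℕ => PowerSeries.coeff p.1 (∏ i ∈ Finset.range N, partSeries i) *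
      PowerSeries.coeff p.2 (partSeries N))
    (fun p _ => mul_nonneg (boundedCoeff_nonneg N p.1) (partSeries_coeff_nonneg N p.2))
    (Finset.HasAntidiagonal.mem_antidiagonal (a := (n, 0)).2 (Nat.add_zero n))
  simpa [h0] using this

theorem boundedCoeff_le (N n : ℕ) : boundedCoeff N n ≤ numPartitions n :=
  (boundedCoeff_mono n).ge_of_tendsto (tendsto_boundedCoeff n) N

theorem hasSum_partSeries (i : ℕ) {q : ℂ} (hq : ‖q‖ < 1) :
    Summable (fun n => ‖((PowerSeries.coeff n (partSeries i) : ℝ) : ℂ) * q ^ n‖) ∧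
      HasSum (fun n => ((PowerSeries.coeff n (partSeries i) : ℝ) : ℂ) * q ^ n)
        (1 - q ^ (i + 1))⁻¹ := by
  have hq' : ‖q ^ (i + 1)‖ < 1 := by
    rw [norm_pow]
    exact pow_lt_one₀ (norm_nonneg _) hq (Nat.succ_ne_zero i)
  constructor
  · refine (summable_geometric_of_lt_one (norm_nonneg q) hq).of_nonneg_of_le
      (fun _ => norm_nonneg _) fun n => ?_
    rw [norm_mul, norm_pow, partSeries, PowerSeries.coeff_mk]
    have : 0 ≤ ‖q‖ ^ n := by positivity
    split_ifs <;> simp [this]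
  · have h := hasSum_geometric_of_norm_lt_one hq'
    have hinj : Function.Injective fun j : ℕ => (i + 1) * j :=
      fun a b hab => Nat.eq_of_mul_eq_mul_left (Nat.succ_pos i) hab
    rw [← hinj.hasSum_iff]
    · have hfun : (fun n => ((PowerSeries.coeff n (partSeries i) : ℝ) : ℂ) * q ^ n) ∘
          (fun j : ℕ => (i + 1) * j) = fun j => (q ^ (i + 1)) ^ j := by
        funext j
        simp [partSeries, pow_mul]
      rw [hfun]
      exact h
    · intro n hn
      rw [partSeries, PowerSeries.coeff_mk, if_neg]
      · simp
      · rintro ⟨k, rfl⟩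
        exact hn ⟨k, rfl⟩

/-- Absolute summability is carried along because the induction multiplies two series. -/
theorem hasSum_boundedCoeff (N : ℕ) {q : ℂ} (hq : ‖q‖ < 1) :
    Summable (fun n => ‖((boundedCoeff N n : ℝ) : ℂ) * q ^ n‖) ∧
      HasSum (fun n => ((boundedCoeff N n : ℝ) : ℂ) * q ^ n)
        (∏ i ∈ Finset.range N, (1 - q ^ (i + 1))⁻¹) := by
  induction N with
  | zero =>
    have h : ∀ n, ((boundedCoeff 0 n : ℝ) : ℂ) * q ^ n = if n = 0 then 1 else 0 := by
      intro n
      rcases Nat.eq_zero_or_pos n with rfl | hn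
      · simp [boundedCoeff]
      · simp [boundedCoeff, PowerSeries.coeff_one, hn.ne']
    simp only [h, Finset.range_zero, Finset.prod_empty]
    refine ⟨(hasSum_ite_eq 0 (1 : ℝ)).summable.congr fun n => ?_, hasSum_ite_eq 0 1⟩
    split_ifs <;> simp
  | succ N ih =>
    obtain ⟨h1, h2⟩ := ih
    obtain ⟨h3, h4⟩ := hasSum_partSeries N hq
    have key : ∀ n, ((boundedCoeff (N + 1) n : ℝ) : ℂ) * q ^ n =
        ∑ p ∈ Finset.HasAntidiagonal.antidiagonal n, (((boundedCoeff N p.1 : ℝ) : ℂ) * q ^ p.1) *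
          (((PowerSeries.coeff p.2 (partSeries N) : ℝ) : ℂ) * q ^ p.2) := by
      intro n
      rw [boundedCoeff, Finset.prod_range_succ, PowerSeries.coeff_mul, Complex.ofReal_sum,
        Finset.sum_mul]
      refine Finset.sum_congr rfl fun p hp => ?_
      rw [← Finset.HasAntidiagonal.mem_antidiagonal.1 hp, pow_add, Complex.ofReal_mul, boundedCoeff]
      ring
    simp only [key]
    have hs := summable_norm_sum_mul_antidiagonal_of_summable_norm h1 h3
    refine ⟨hs, ?_⟩
    rw [Finset.prod_range_succ, ← h2.tsum_eq, ← h4.tsum_eq,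
      tsum_mul_tsum_eq_tsum_sum_antidiagonal_of_summable_norm h1 h3]
    exact hs.of_norm.hasSum

theorem eulerProduct_ne_zero {q : ℂ} (hq : ‖q‖ < 1) : ∏' n : ℕ, (1 - q ^ (n + 1)) ≠ 0 := by
  have := tprod_one_add_ne_zero_of_summable (f := fun n : ℕ => -q ^ (n + 1)) (fun n h => ?_) ?_
  · simpa [sub_eq_add_neg] using this
  · have h1 : q ^ (n + 1) = 1 := by linear_combination -h
    have h2 : ‖q ^ (n + 1)‖ < 1 := by
      rw [norm_pow]
      exact pow_lt_one₀ (norm_nonneg _) hq (Nat.succ_ne_zero n)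
    rw [h1] at h2
    simp at h2
  · simpa using (summable_nat_add_iff 1).mpr (summable_geometric_of_lt_one (norm_nonneg _) hq)

/-- The finite products of geometric series tend to the inverse of the Euler product. -/
theorem tendsto_prod_inv {q : ℂ} (hq : ‖q‖ < 1) :
    Tendsto (fun N => ∏ i ∈ Finset.range N, (1 - q ^ (i + 1))⁻¹) atTop
      (nhds (∏' n : ℕ, (1 - q ^ (n + 1)))⁻¹) := by
  simp only [Finset.prod_inv_distrib]
  exact ((ModularForm.multipliable_one_sub_pow hq).hasProd.tendsto_prod_nat).inv₀
    (eulerProduct_ne_zero hq)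

/-- The partial sums are bounded by the inverse of the Euler product at `r`, since the coefficients
`boundedCoeff N n` increase to `p(n)`. -/
theorem summable_numPartitions {r : ℝ} (h0 : 0 ≤ r) (h1 : r < 1) :
    Summable fun n => (numPartitions n : ℝ) * r ^ n := by
  have hq : ‖(r : ℂ)‖ < 1 := by simpa [abs_of_nonneg h0] using h1
  have hlim := (tendsto_prod_inv hq).norm
  refine summable_of_sum_le (c := ‖(∏' n : ℕ, (1 - (r : ℂ) ^ (n + 1)))⁻¹‖)
    (fun n => by positivity) fun u => ?_
  refine le_of_tendsto_of_tendsto'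
    (tendsto_finsetSum u fun n _ => (tendsto_boundedCoeff n).mul_const (r ^ n)) hlim fun N => ?_
  obtain ⟨h2, h3⟩ := hasSum_boundedCoeff N hq
  have h4 : Summable fun n => boundedCoeff N n * r ^ n := by
    refine h2.congr fun n => ?_
    rw [norm_mul, norm_pow, Complex.norm_real, Complex.norm_real, Real.norm_of_nonneg h0,
      Real.norm_of_nonneg (boundedCoeff_nonneg N n)]
  have h5 : ∑' n, boundedCoeff N n * r ^ n ≤
      ‖∏ i ∈ Finset.range N, (1 - (r : ℂ) ^ (i + 1))⁻¹‖ := by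
    rw [← h3.tsum_eq]
    have : ((∑' n, boundedCoeff N n * r ^ n : ℝ) : ℂ) =
        ∑' n, ((boundedCoeff N n : ℝ) : ℂ) * (r : ℂ) ^ n := by
      rw [Complex.ofReal_tsum]
      simp
    rw [← this, Complex.norm_real]
    exact le_abs_self _
  exact (h4.sum_le_tsum u fun n _ => mul_nonneg (boundedCoeff_nonneg N n) (by positivity)).trans h5

/-- The partition generating function `∑ p(n) q ^ n`. -/
noncomputable def partitionSeries (q : ℂ) : ℂ := ∑' n, (numPartitions n : ℂ) * q ^ n

theorem summable_norm_partitionSeries {q : ℂ} (hq : ‖q‖ < 1) :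
    Summable fun n => ‖(numPartitions n : ℂ) * q ^ n‖ := by
  simpa using summable_numPartitions (norm_nonneg q) hq

theorem partitionSeries_eq_inv {q : ℂ} (hq : ‖q‖ < 1) :
    partitionSeries q = (∏' n : ℕ, (1 - q ^ (n + 1)))⁻¹ := by
  refine tendsto_nhds_unique ?_ (tendsto_prod_inv hq)
  have h : Tendsto (fun N => ∑' n, ((boundedCoeff N n : ℝ) : ℂ) * q ^ n) atTop
      (nhds (partitionSeries q)) := by
    refine tendsto_tsum_of_dominated_convergence
      (summable_norm_partitionSeries hq) (fun n => ?_) (Eventually.of_forall fun N n => ?_)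
    · have := (Complex.continuous_ofReal.tendsto _).comp (tendsto_boundedCoeff n)
      simpa using this.mul_const (q ^ n)
    · rw [norm_mul, norm_mul, Complex.norm_real, Real.norm_of_nonneg (boundedCoeff_nonneg N n)]
      gcongr
      simpa using boundedCoeff_le N n
  exact h.congr fun N => (hasSum_boundedCoeff N hq).2.tsum_eq

/-! ### The modular transformation and the minor arcs -/

theorem norm_exp_neg_lt_one {z : ℂ} (hz : 0 < z.re) : ‖Complex.exp (-z)‖ < 1 := by
  rw [Complex.norm_exp]
  simpa using hz

theorem csqrt_I_mul {z : ℂ} (hz : 0 < z.re) :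
    Complex.sqrt (Complex.I * z) = Complex.sqrt Complex.I * Complex.sqrt z := by
  have hz0 : z ≠ 0 := by rintro rfl; simp at hz
  have h := abs_lt.1 (Complex.abs_arg_lt_pi_div_two_iff.2 (Or.inl hz))
  have harg : Complex.arg Complex.I + Complex.arg z ∈ Set.Ioc (-Real.pi) Real.pi := by
    rw [Complex.arg_I]
    constructor <;> linarith [Real.pi_pos]
  rw [Complex.sqrt, Complex.sqrt, Complex.sqrt, Complex.cpow_def_of_ne_zero Complex.I_ne_zero,
    Complex.cpow_def_of_ne_zero hz0,
    Complex.cpow_def_of_ne_zero (mul_ne_zero Complex.I_ne_zero hz0),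
    Complex.log_mul Complex.I_ne_zero hz0 harg, add_mul, Complex.exp_add]

/-- The functional equation of the generating function, which is that of the Dedekind eta function
at `τ = i z / (2π)`. -/
theorem partitionSeries_modular {z : ℂ} (hz : 0 < z.re) :
    partitionSeries (Complex.exp (-z)) =
      Complex.sqrt (z / (2 * Real.pi)) *
        Complex.exp (Real.pi ^ 2 / (6 * z) - z / 24) *
        partitionSeries (Complex.exp (-(4 * Real.pi ^ 2 / z))) := by
  have hpi : (Real.pi : ℂ) ≠ 0 := Complex.ofReal_ne_zero.2 Real.pi_ne_zero
  have hz0 : z ≠ 0 := by rintro rfl; simp at hz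
  have hdre : 0 < (4 * (Real.pi : ℂ) ^ 2 / z).re := by
    have : (4 * (Real.pi : ℂ) ^ 2 / z).re = 4 * Real.pi ^ 2 * (z.re / Complex.normSq z) := by
      rw [show (4 * (Real.pi : ℂ) ^ 2 / z) = ((4 * Real.pi ^ 2 : ℝ) : ℂ) * z⁻¹ by
        push_cast; rfl, Complex.re_ofReal_mul, Complex.inv_re]
    rw [this]
    have := Complex.normSq_pos.2 hz0
    positivity
  set t : ℂ := Complex.I * (z / (2 * Real.pi)) with ht
  have hzre : 0 < (z / (2 * Real.pi)).re := by
    rw [show (2 * (Real.pi : ℂ)) = ((2 * Real.pi : ℝ) : ℂ) by push_cast; rfl,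
      Complex.div_ofReal_re]
    positivity
  have htim : t ∈ UpperHalfPlane.upperHalfPlaneSet := by
    show 0 < t.im
    rw [ht, Complex.I_mul_im]
    exact hzre
  have h := ModularForm.eta_comp_eq_csqrt_I_inv htim
  simp only [Function.comp_apply, Pi.smul_apply, Pi.mul_apply, smul_eq_mul] at h
  have hI : Complex.sqrt Complex.I ≠ 0 := by simp [Complex.sqrt]
  rw [ht, csqrt_I_mul hzre, ← ht] at h
  have e1 : ModularForm.eta t =
      Complex.exp (-z / 24) * ∏' n : ℕ, (1 - Complex.exp (-z) ^ (n + 1)) := by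
    rw [ModularForm.eta, Function.Periodic.qParam]
    congr 1
    · congr 1
      rw [ht]
      field_simp
      push_cast
      linear_combination 24 * Complex.I_sq
    · refine tprod_congr fun n => ?_
      rw [ModularForm.eta_q_eq_pow]
      congr 3
      rw [ht]
      field_simp
      linear_combination Complex.I_sq
  have e2 : ModularForm.eta (-1 / t) =
      Complex.exp (-(Real.pi ^ 2 / (6 * z))) *
        ∏' n : ℕ, (1 - Complex.exp (-(4 * Real.pi ^ 2 / z)) ^ (n + 1)) := by
    have ht' : -1 / t = 2 * Real.pi * Complex.I / z := by
      rw [ht]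
      field_simp
      linear_combination -Complex.I_sq
    rw [ht', ModularForm.eta, Function.Periodic.qParam]
    congr 1
    · congr 1
      field_simp
      push_cast
      linear_combination 24 * Complex.I_sq
    · refine tprod_congr fun n => ?_
      rw [ModularForm.eta_q_eq_pow]
      congr 3
      field_simp
      linear_combination 4 * Complex.I_sq
  rw [e1, e2] at h
  have hD := eulerProduct_ne_zero (norm_exp_neg_lt_one hz)
  have hD' := eulerProduct_ne_zero (norm_exp_neg_lt_one hdre)
  rw [partitionSeries_eq_inv (norm_exp_neg_lt_one hz),
    partitionSeries_eq_inv (norm_exp_neg_lt_one hdre)]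
  rw [neg_div, Complex.exp_neg (z / 24), Complex.exp_neg (Real.pi ^ 2 / (6 * z))] at h
  rw [Complex.exp_sub]
  have hE1 := Complex.exp_ne_zero (Real.pi ^ 2 / (6 * z))
  have hE2 := Complex.exp_ne_zero (z / 24)
  generalize ∏' n : ℕ, (1 - Complex.exp (-(4 * Real.pi ^ 2 / z)) ^ (n + 1)) = D' at *
  generalize ∏' n : ℕ, (1 - Complex.exp (-z) ^ (n + 1)) = D at *
  generalize Complex.sqrt (z / (2 * Real.pi)) = S at *
  generalize Complex.exp (Real.pi ^ 2 / (6 * z)) = E1 at *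
  generalize Complex.exp (z / 24) = E2 at *
  field_simp at h ⊢
  linear_combination h

/-- `P(q) = 1 + O(q)` near the origin. -/
theorem exists_norm_partitionSeries_sub_one_le :
    ∃ C : ℝ, 0 < C ∧ ∀ q : ℂ, ‖q‖ ≤ 1 / 2 → ‖partitionSeries q - 1‖ ≤ C * ‖q‖ := by
  have hs := (summable_nat_add_iff 1).2
    (summable_numPartitions (r := 1 / 2) (by norm_num) (by norm_num))
  set C := ∑' n, (numPartitions (n + 1) : ℝ) * (1 / 2) ^ (n + 1) with hC
  have hC0 : 0 ≤ C := tsum_nonneg fun n => by positivity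
  refine ⟨2 * C + 1, by positivity, fun q hq => ?_⟩
  have hq1 : ‖q‖ < 1 := by linarith
  have hsum := summable_norm_partitionSeries hq1
  have h0 : numPartitions 0 = 1 := by simp [numPartitions]
  have h1 : partitionSeries q - 1 = ∑' n, (numPartitions (n + 1) : ℂ) * q ^ (n + 1) := by
    rw [partitionSeries, hsum.of_norm.tsum_eq_zero_add, h0]
    simp
  have hle : ∀ n, ‖(numPartitions (n + 1) : ℂ) * q ^ (n + 1)‖ ≤
      (numPartitions (n + 1) : ℝ) * (1 / 2) ^ (n + 1) * (2 * ‖q‖) := by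
    intro n
    rw [norm_mul, norm_pow, Complex.norm_natCast]
    have : ‖q‖ ^ n ≤ (1 / 2) ^ n := pow_le_pow_left₀ (norm_nonneg q) hq n
    calc (numPartitions (n + 1) : ℝ) * ‖q‖ ^ (n + 1)
        = (numPartitions (n + 1) : ℝ) * ‖q‖ ^ n * ‖q‖ := by ring
      _ ≤ (numPartitions (n + 1) : ℝ) * (1 / 2) ^ n * ‖q‖ := by gcongr
      _ = _ := by ring
  have h2 := tsum_of_norm_bounded (hs.mul_right (2 * ‖q‖)).hasSum hle
  rw [h1]
  refine h2.trans ?_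
  rw [tsum_mul_right, ← hC]
  nlinarith [norm_nonneg q]

theorem norm_one_sub_exp_sq (x θ : ℝ) :
    ‖1 - Complex.exp (-(x + θ * Complex.I))‖ ^ 2 =
      (1 - Real.exp (-x)) ^ 2 + 2 * Real.exp (-x) * (1 - Real.cos θ) := by
  rw [← Complex.normSq_eq_norm_sq, Complex.normSq_apply]
  simp only [Complex.sub_re, Complex.sub_im, Complex.one_re, Complex.one_im, Complex.exp_re,
    Complex.exp_im, Complex.neg_re, Complex.neg_im, Complex.add_re, Complex.add_im,
    Complex.ofReal_re, Complex.ofReal_im, Complex.re_ofReal_mul, Complex.im_ofReal_mul,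
    Complex.I_re, Complex.I_im, mul_zero, mul_one, add_zero, zero_add, Real.cos_neg, Real.sin_neg]
  linear_combination Real.exp (-x) ^ 2 * Real.sin_sq_add_cos_sq θ

/-- A factor `1 - e^{-y}` of the Euler product grows when its argument is rotated by `φ`, by a
quantifiable amount as long as `y ≤ 1`. -/
theorem factor_le {y φ : ℝ} (hy0 : 0 < y) (hy1 : y ≤ 1) :
    1 - Real.exp (-y) ≤
      ‖1 - Complex.exp (-(y + φ * Complex.I))‖ * Real.exp (-(1 - Real.cos φ) / 8) := by
  have hr0 : Real.exp (-y) < 1 := by simpa using hy0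
  have hr1 : 1 / 3 ≤ Real.exp (-y) := by
    have h1 : Real.exp (-1) ≤ Real.exp (-y) := Real.exp_le_exp.2 (by linarith)
    have h2 : Real.exp 1 < 3 := by linarith [Real.exp_one_lt_d9]
    rw [Real.exp_neg] at h1
    have h3 : (3 : ℝ)⁻¹ ≤ (Real.exp 1)⁻¹ := by gcongr
    linarith
  set r := Real.exp (-y) with hr
  set c := 1 - Real.cos φ with hc
  have hc0 : 0 ≤ c := by linarith [Real.cos_le_one φ]
  have hc2 : c ≤ 2 := by linarith [Real.neg_one_le_cos φ]
  have hexp : Real.exp (c / 4) ≤ 1 + 2 / 3 * c := by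
    refine (Real.exp_bound_div_one_sub_of_interval (by positivity) (by linarith)).trans ?_
    rw [div_le_iff₀ (by linarith)]
    nlinarith
  refine abs_le_of_sq_le_sq' ?_ (by positivity) |>.2
  rw [mul_pow, norm_one_sub_exp_sq, ← hr, ← hc, ← Real.exp_nat_mul]
  have h1 : (1 - r) ^ 2 * Real.exp (c / 4) ≤ (1 - r) ^ 2 + 2 * r * c := by
    have h2 : (1 - r) ^ 2 ≤ 1 := by nlinarith
    calc (1 - r) ^ 2 * Real.exp (c / 4) ≤ (1 - r) ^ 2 * (1 + 2 / 3 * c) := by gcongr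
      _ ≤ (1 - r) ^ 2 + 2 * r * c := by nlinarith
  calc (1 - r) ^ 2 = (1 - r) ^ 2 * Real.exp (c / 4) * Real.exp (-(c / 4)) := by
        rw [mul_assoc, ← Real.exp_add]; simp
    _ ≤ ((1 - r) ^ 2 + 2 * r * c) * Real.exp (-(c / 4)) := by gcongr
    _ = _ := by congr 2; push_cast; ring

/-- The Dirichlet kernel bound, by summing the geometric series in `exp (i θ)`. -/
theorem sum_cos_le {θ : ℝ} (h0 : 0 < |θ|) (hpi : |θ| ≤ Real.pi) (M : ℕ) :
    ∑ m ∈ Finset.range M, Real.cos ((m + 1 : ℕ) * θ) ≤ Real.pi / |θ| := by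
  set w := Complex.exp (θ * Complex.I) with hw
  have hw1 : ‖w‖ = 1 := Complex.norm_exp_ofReal_mul_I θ
  have hlow : 2 * |θ| / Real.pi ≤ ‖w - 1‖ := by
    rw [hw, mul_comm (θ : ℂ), Complex.norm_exp_I_mul_ofReal_sub_one, Real.norm_eq_abs, abs_mul,
      abs_two]
    have := Real.mul_abs_le_abs_sin (x := θ / 2) (by rw [abs_div, abs_two]; linarith)
    rw [abs_div, abs_two] at this
    calc 2 * |θ| / Real.pi = 2 * (2 / Real.pi * (|θ| / 2)) := by ring
      _ ≤ _ := by gcongr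
  have hne : w - 1 ≠ 0 := by
    intro h
    rw [h, norm_zero] at hlow
    have : 0 < 2 * |θ| / Real.pi := by have := Real.pi_pos; positivity
    linarith
  have hsum : ∑ m ∈ Finset.range M, Real.cos ((m + 1 : ℕ) * θ) =
      (w * ∑ m ∈ Finset.range M, w ^ m).re := by
    rw [Finset.mul_sum, Complex.re_sum]
    refine Finset.sum_congr rfl fun m _ => ?_
    rw [← pow_succ', hw, ← Complex.exp_nat_mul, ← mul_assoc,
      show ((m + 1 : ℕ) : ℂ) * (θ : ℂ) = (((m + 1 : ℕ) * θ : ℝ) : ℂ) by push_cast; rfl,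
      Complex.exp_ofReal_mul_I_re]
  rw [hsum, geom_sum_eq (sub_ne_zero.1 hne)]
  refine (Complex.re_le_norm _).trans ?_
  rw [norm_mul, norm_div, hw1, one_mul]
  have h2 : ‖w ^ M - 1‖ ≤ 2 := by
    refine (norm_sub_le _ _).trans ?_
    rw [norm_pow, hw1]
    norm_num
  have hpp := Real.pi_pos
  calc ‖w ^ M - 1‖ / ‖w - 1‖ ≤ 2 / (2 * |θ| / Real.pi) := by gcongr
    _ = Real.pi / |θ| := by field_simp

/-- On the minor arcs `|θ| ≥ 13 x` the generating function is exponentially smaller than on the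
positive real axis. -/
theorem norm_partitionSeries_minor {x θ : ℝ} (hx : 0 < x) (hx2 : x ≤ 1 / 2)
    (hθ : 13 * x ≤ |θ|) (hpi : |θ| ≤ Real.pi) :
    ‖partitionSeries (Complex.exp (-(x + θ * Complex.I)))‖ ≤
      Real.exp (-1 / (32 * x)) * ‖partitionSeries (Complex.exp (-(x : ℂ)))‖ := by
  set q := Complex.exp (-(x + θ * Complex.I)) with hq
  set r := Complex.exp (-(x : ℂ)) with hr
  have hq1 : ‖q‖ < 1 := norm_exp_neg_lt_one (by simpa using hx)
  have hr1 : ‖r‖ < 1 := norm_exp_neg_lt_one (by simpa using hx)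
  have hqn : ∀ m : ℕ, q ^ (m + 1) =
      Complex.exp (-(((m + 1 : ℕ) * x : ℝ) + ((m + 1 : ℕ) * θ : ℝ) * Complex.I)) := by
    intro m
    rw [hq, ← Complex.exp_nat_mul]
    congr 1
    push_cast
    ring
  have hrn : ∀ m : ℕ, ‖1 - r ^ (m + 1)‖ = 1 - Real.exp (-((m + 1 : ℕ) * x)) := by
    intro m
    rw [hr, ← Complex.exp_nat_mul, show ((m + 1 : ℕ) : ℂ) * -(x : ℂ) =
      ((-((m + 1 : ℕ) * x) : ℝ) : ℂ) by push_cast; ring, ← Complex.ofReal_exp,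
      ← Complex.ofReal_one, ← Complex.ofReal_sub, Complex.norm_real, Real.norm_of_nonneg]
    have : Real.exp (-((m + 1 : ℕ) * x)) ≤ 1 := by
      rw [Real.exp_le_one_iff, neg_nonpos]
      positivity
    linarith
  set M := ⌊1 / x⌋₊ with hM
  have hMle : (M : ℝ) ≤ 1 / x := Nat.floor_le (by positivity)
  have hMge : 1 / x - 1 ≤ (M : ℝ) := (Nat.sub_one_lt_floor _).le
  -- `e m` bounds the quotient of the `m`-th factors; beyond `M` the trivial bound `1` is used.
  let e : ℕ → ℝ := fun m => if m < M then Real.exp (-(1 - Real.cos ((m + 1 : ℕ) * θ)) / 8) else 1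
  have hfac : ∀ m : ℕ, ‖1 - r ^ (m + 1)‖ ≤ ‖1 - q ^ (m + 1)‖ * e m := by
    intro m
    simp only [e]
    rw [hrn, hqn]
    split_ifs with hm
    · refine factor_le (by positivity) ?_
      have : ((m + 1 : ℕ) : ℝ) ≤ M := by exact_mod_cast hm
      calc ((m + 1 : ℕ) : ℝ) * x ≤ 1 / x * x := by gcongr; linarith
        _ = 1 := by field_simp
    · rw [mul_one]
      refine abs_le_of_sq_le_sq' ?_ (norm_nonneg _) |>.2
      rw [norm_one_sub_exp_sq]
      have := Real.cos_le_one ((m + 1 : ℕ) * θ)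
      have := Real.exp_pos (-((m + 1 : ℕ) * x))
      nlinarith
  have hpow : ∀ N, M ≤ N → ∏ m ∈ Finset.range N, e m ≤ Real.exp (-1 / (32 * x)) := by
    intro N hN
    have h1 : ∏ m ∈ Finset.range N, e m =
        ∏ m ∈ Finset.range M, Real.exp (-(1 - Real.cos ((m + 1 : ℕ) * θ)) / 8) := by
      rw [← Finset.prod_subset (Finset.range_mono hN)]
      · exact Finset.prod_congr rfl fun m hm => if_pos (Finset.mem_range.1 hm)
      · intro m _ hm
        exact if_neg (by simpa using hm)
    rw [h1, ← Real.exp_sum, Real.exp_le_exp, ← Finset.sum_div, Finset.sum_neg_distrib,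
      Finset.sum_sub_distrib]
    have h2 := sum_cos_le (by linarith) hpi M
    have h3 : Real.pi / |θ| ≤ 1 / (4 * x) := by
      calc Real.pi / |θ| ≤ 3.15 / (13 * x) := by
            gcongr
            exact Real.pi_lt_d2.le
        _ ≤ 1 / (4 * x) := by
            rw [div_le_div_iff₀ (by positivity) (by positivity)]
            nlinarith
    have h4 : 2 ≤ 1 / x := by
      rw [le_div_iff₀ hx]
      linarith
    have h5 : 1 / (4 * x) = 1 / x / 4 := by field_simp
    have h6 : -1 / (32 * x) = -(1 / x) / 32 := by field_simp
    simp only [Finset.sum_const, Finset.card_range, nsmul_eq_mul, mul_one]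
    rw [h6]
    linarith
  rw [partitionSeries_eq_inv hq1, partitionSeries_eq_inv hr1]
  refine le_of_tendsto_of_tendsto (tendsto_prod_inv hq1).norm
    ((tendsto_prod_inv hr1).norm.const_mul _) ?_
  filter_upwards [eventually_ge_atTop M] with N hN
  refine le_trans ?_ (mul_le_mul_of_nonneg_right (hpow N hN) (norm_nonneg _))
  rw [norm_prod, norm_prod, ← Finset.prod_mul_distrib]
  refine Finset.prod_le_prod (fun _ _ => norm_nonneg _) fun m _ => ?_
  rw [norm_inv, norm_inv, ← div_eq_mul_inv, inv_eq_one_div]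
  have hrpos : 0 < ‖1 - r ^ (m + 1)‖ := by
    rw [hrn, sub_pos, Real.exp_lt_one_iff, neg_lt_zero]
    positivity
  have hqpos : 0 < ‖1 - q ^ (m + 1)‖ := by
    refine (norm_nonneg _).lt_of_ne fun h => ?_
    have := hfac m
    rw [← h, zero_mul] at this
    linarith
  rw [div_le_div_iff₀ hqpos hrpos, one_mul, mul_comm]
  exact hfac m

/-! ### The saddle point integral -/

theorem exists_expSqPrimitive :
    ∃ Φ : ℂ → ℂ, Φ 0 = 0 ∧ ∀ w, HasDerivAt Φ (Complex.exp (w ^ 2)) w := by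
  have h : Differentiable ℂ fun w : ℂ => Complex.exp (w ^ 2) := by fun_prop
  obtain ⟨Φ, h0, hΦ⟩ := (h.isExactOn_univ).with_val_at 0 0
  exact ⟨Φ, h0, fun w => hΦ w (Set.mem_univ w)⟩

/-- The entire primitive of `exp (w ^ 2)` vanishing at `0`, a rotated error function. -/
noncomputable def expSqPrimitive : ℂ → ℂ := exists_expSqPrimitive.choose

theorem expSqPrimitive_zero : expSqPrimitive 0 = 0 := exists_expSqPrimitive.choose_spec.1

theorem hasDerivAt_expSqPrimitive (w : ℂ) :
    HasDerivAt expSqPrimitive (Complex.exp (w ^ 2)) w := exists_expSqPrimitive.choose_spec.2 w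

theorem expSqPrimitive_ray (t : ℝ) (ω : ℂ) :
    expSqPrimitive (t * ω) = ω * ∫ y in (0 : ℝ)..t, Complex.exp (ω ^ 2 * (y : ℂ) ^ 2) := by
  have hd : ∀ y : ℝ, HasDerivAt (fun y : ℝ => expSqPrimitive (y * ω))
      (ω * Complex.exp (ω ^ 2 * (y : ℂ) ^ 2)) y := by
    intro y
    have h1 : HasDerivAt (fun y : ℂ => y * ω) ω (y : ℂ) := by
      simpa using (hasDerivAt_id (y : ℂ)).mul_const ω
    have h2 := ((hasDerivAt_expSqPrimitive ((y : ℂ) * ω)).comp (y : ℂ) h1).comp_ofReal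
    convert! h2 using 1
    rw [mul_comm]
    congr 2
    ring
  have h := intervalIntegral.integral_eq_sub_of_hasDerivAt (fun y _ => hd y)
    ((by fun_prop : Continuous fun y : ℝ =>
      ω * Complex.exp (ω ^ 2 * (y : ℂ) ^ 2)).intervalIntegrable 0 t)
  rw [intervalIntegral.integral_const_mul] at h
  rw [h]
  simp [expSqPrimitive_zero]

theorem norm_exp_mul_sq (ω : ℂ) (y : ℝ) :
    ‖Complex.exp (ω ^ 2 * (y : ℂ) ^ 2)‖ = Real.exp ((ω ^ 2).re * y ^ 2) := by
  rw [Complex.norm_exp]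
  congr 1
  rw [← Complex.ofReal_pow, Complex.re_mul_ofReal]

theorem norm_expSqPrimitive_ray_le {t : ℝ} (ht : 0 ≤ t) {ω : ℂ} (hω : 0 ≤ (ω ^ 2).re) :
    ‖expSqPrimitive (t * ω)‖ ≤ ‖ω‖ * (Real.exp ((ω ^ 2).re * t ^ 2) * t) := by
  rw [expSqPrimitive_ray, norm_mul]
  gcongr
  refine (intervalIntegral.norm_integral_le_of_norm_le_const fun y hy => ?_).trans_eq
    (by rw [sub_zero, abs_of_nonneg ht])
  rw [Set.uIoc_of_le ht] at hy
  rw [norm_exp_mul_sq, Real.exp_le_exp]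
  gcongr
  · exact hy.1.le
  · exact hy.2

/-- In the sectors around the imaginary axis, the primitive of `exp (w ^ 2)` tends to
`± i √π / 2` along rays, with a Gaussian error. -/
theorem exists_norm_expSqPrimitive_sub_le {ω : ℂ} (hω : (ω ^ 2).re < 0) {σ : ℝ} (hσ : σ ^ 2 = 1)
    (him : 0 < σ * ω.im) :
    ∃ C : ℝ, 0 < C ∧ ∀ t : ℝ, 0 ≤ t →
      ‖expSqPrimitive (t * ω) - Complex.I * σ * (Real.sqrt Real.pi / 2 : ℝ)‖ ≤
        C * Real.exp ((ω ^ 2).re / 2 * t ^ 2) := by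
  set β := -(ω ^ 2).re with hβ
  have hβ0 : 0 < β := by linarith
  have hb : 0 < (-ω ^ 2).re := by simpa [hβ] using hβ0
  have hint := integrable_cexp_neg_mul_sq hb
  simp only [neg_neg] at hint
  have hvalue : ω * ∫ y in Set.Ioi (0 : ℝ), Complex.exp (ω ^ 2 * (y : ℂ) ^ 2) =
      Complex.I * σ * (Real.sqrt Real.pi / 2 : ℝ) := by
    have h1 := integral_gaussian_complex_Ioi hb
    simp only [neg_neg] at h1
    rw [h1]
    -- `-ω ^ 2` is the square of `-i σ ω`, which lies in the right half-plane.
    set ρ : ℂ := -(Complex.I * σ * ω) with hρ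
    have hσ' : (σ : ℂ) ^ 2 = 1 := by exact_mod_cast hσ
    have hsq : -ω ^ 2 = ρ ^ 2 := by
      rw [hρ]
      linear_combination (-σ ^ 2 * ω ^ 2) * Complex.I_sq + ω ^ 2 * hσ'
    have hre : 0 < ρ.re := by
      rw [hρ]
      simpa [Complex.mul_re, Complex.mul_im] using him
    have hρ0 : ρ ≠ 0 := by intro h; simp [h] at hre
    have hroot : (Real.pi / -ω ^ 2 : ℂ) ^ (1 / 2 : ℂ) = (Real.sqrt Real.pi : ℝ) / ρ := by
      have h2 : (Real.pi / -ω ^ 2 : ℂ) = ((Real.sqrt Real.pi : ℝ) / ρ) ^ 2 := by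
        rw [hsq, div_pow, ← Complex.ofReal_pow, Real.sq_sqrt Real.pi_pos.le]
      rw [h2, one_div, Complex.sq_cpow_two_inv]
      rw [div_eq_mul_inv, Complex.re_ofReal_mul, Complex.inv_re]
      have := Complex.normSq_pos.2 hρ0
      have := Real.sqrt_pos.2 Real.pi_pos
      positivity
    rw [hroot]
    have hω' : ω = Complex.I * σ * ρ := by
      rw [hρ]
      linear_combination (σ ^ 2 * ω) * Complex.I_sq - ω * hσ'
    rw [hω']
    field_simp
    push_cast
    ring
  have hreal : Integrable fun y : ℝ => Real.exp (-(β / 2) * y ^ 2) :=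
    integrable_exp_neg_mul_sq (by positivity)
  set G := ∫ y in Set.Ioi (0 : ℝ), Real.exp (-(β / 2) * y ^ 2) with hG
  have hG0 : 0 ≤ G := integral_nonneg fun y => (Real.exp_pos _).le
  refine ⟨‖ω‖ * G + 1, by positivity, fun t ht => ?_⟩
  have hsplit : (∫ y in (0 : ℝ)..t, Complex.exp (ω ^ 2 * (y : ℂ) ^ 2)) -
      ∫ y in Set.Ioi (0 : ℝ), Complex.exp (ω ^ 2 * (y : ℂ) ^ 2) =
      -∫ y in Set.Ioi t, Complex.exp (ω ^ 2 * (y : ℂ) ^ 2) := by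
    rw [← intervalIntegral.integral_Ioi_sub_Ioi hint.integrableOn ht]
    ring
  rw [expSqPrimitive_ray, ← hvalue, ← mul_sub, hsplit, norm_mul, norm_neg]
  have htail : ‖∫ y in Set.Ioi t, Complex.exp (ω ^ 2 * (y : ℂ) ^ 2)‖ ≤
      G * Real.exp ((ω ^ 2).re / 2 * t ^ 2) := by
    calc ‖∫ y in Set.Ioi t, Complex.exp (ω ^ 2 * (y : ℂ) ^ 2)‖
        ≤ ∫ y in Set.Ioi t, Real.exp (-(β / 2) * y ^ 2) * Real.exp ((ω ^ 2).re / 2 * t ^ 2) := by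
          refine norm_integral_le_of_norm_le (hreal.integrableOn.mul_const _) ?_
          filter_upwards [ae_restrict_mem measurableSet_Ioi] with y hy
          rw [norm_exp_mul_sq, ← Real.exp_add, Real.exp_le_exp]
          have : t ^ 2 ≤ y ^ 2 := pow_le_pow_left₀ ht (le_of_lt hy) 2
          nlinarith
      _ = (∫ y in Set.Ioi t, Real.exp (-(β / 2) * y ^ 2)) *
          Real.exp ((ω ^ 2).re / 2 * t ^ 2) := integral_mul_const _ _
      _ ≤ _ := by
          gcongr
          exact setIntegral_mono_set hreal.integrableOn
            (Eventually.of_forall fun y => (Real.exp_pos _).le)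
            (Set.Ioi_subset_Ioi ht).eventuallyLE
  calc ‖ω‖ * ‖∫ y in Set.Ioi t, Complex.exp (ω ^ 2 * (y : ℂ) ^ 2)‖
      ≤ ‖ω‖ * (G * Real.exp ((ω ^ 2).re / 2 * t ^ 2)) := by gcongr
    _ ≤ _ := by
      rw [← mul_assoc]
      gcongr
      linarith

theorem csqrt_sq (z : ℂ) : Complex.sqrt z ^ 2 = z := by
  rw [Complex.sqrt]
  exact_mod_cast Complex.cpow_nat_inv_pow z two_ne_zero

theorem csqrt_ne_zero {z : ℂ} (hz : z ≠ 0) : Complex.sqrt z ≠ 0 := by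
  intro h
  have := csqrt_sq z
  rw [h] at this
  exact hz (by simpa using this.symm)

theorem hasDerivAt_csqrt {z : ℂ} (hz : 0 < z.re) :
    HasDerivAt Complex.sqrt (1 / (2 * Complex.sqrt z)) z := by
  have hz0 : z ≠ 0 := by rintro rfl; simp at hz
  have h := (hasDerivAt_id z).cpow_const (c := (2⁻¹ : ℂ)) (Or.inl hz)
  convert! h using 1
  have h1 : z ^ (2⁻¹ - 1 : ℂ) = Complex.sqrt z / z := by
    rw [Complex.cpow_sub _ _ hz0, Complex.cpow_one, Complex.sqrt]
  have h2 := csqrt_ne_zero hz0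
  simp only [id_eq, mul_one, h1]
  rw [div_eq_iff (by simpa using h2)]
  field_simp
  exact (csqrt_sq z).symm

/-- An explicit primitive of `√ζ * exp (t² * (ζ + 1 / ζ))` on the right half-plane. The parameter is
`t = √N` rather than `N`, since `√N` multiplies the arguments of `expSqPrimitive`. -/
noncomputable def saddlePrimitive (t : ℝ) (ζ : ℂ) : ℂ :=
  1 / (t : ℂ) ^ 2 * (Complex.sqrt ζ * Complex.exp (t ^ 2 * (ζ + ζ⁻¹)) +
    (t - 1 / (2 * t)) * Complex.exp (2 * t ^ 2) *
      expSqPrimitive (t * (Complex.sqrt ζ - (Complex.sqrt ζ)⁻¹)) -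
    (t + 1 / (2 * t)) * Complex.exp (-(2 * t ^ 2)) *
      expSqPrimitive (t * (Complex.sqrt ζ + (Complex.sqrt ζ)⁻¹)))

theorem hasDerivAt_saddlePrimitive {t : ℝ} (ht : 0 < t) {ζ : ℂ} (hζ : 0 < ζ.re) :
    HasDerivAt (saddlePrimitive t) (Complex.sqrt ζ * Complex.exp (t ^ 2 * (ζ + ζ⁻¹))) ζ := by
  have hζ0 : ζ ≠ 0 := by rintro rfl; simp at hζ
  have hu0 := csqrt_ne_zero hζ0
  have husq := csqrt_sq ζ
  have ht0 : (t : ℂ) ≠ 0 := by exact_mod_cast ht.ne'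
  have hu := hasDerivAt_csqrt hζ
  have hE : HasDerivAt (fun ζ : ℂ => Complex.exp (t ^ 2 * (ζ + ζ⁻¹)))
      (Complex.exp (t ^ 2 * (ζ + ζ⁻¹)) * (t ^ 2 * (1 + -(ζ ^ 2)⁻¹))) ζ :=
    (((hasDerivAt_id ζ).add (hasDerivAt_inv hζ0)).const_mul _).cexp
  have hw := (hasDerivAt_expSqPrimitive (t * (Complex.sqrt ζ - (Complex.sqrt ζ)⁻¹))).comp ζ
    ((hu.sub (hu.inv hu0)).const_mul (t : ℂ))
  have hv := (hasDerivAt_expSqPrimitive (t * (Complex.sqrt ζ + (Complex.sqrt ζ)⁻¹))).comp ζ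
    ((hu.add (hu.inv hu0)).const_mul (t : ℂ))
  have h := ((((hu.mul hE).add (hw.const_mul ((t - 1 / (2 * t)) * Complex.exp (2 * t ^ 2)))).sub
    (hv.const_mul ((t + 1 / (2 * t)) * Complex.exp (-(2 * t ^ 2))))).const_mul (1 / (t : ℂ) ^ 2))
  have e1 : Complex.exp ((t * (Complex.sqrt ζ - (Complex.sqrt ζ)⁻¹)) ^ 2) =
      Complex.exp (t ^ 2 * (ζ + ζ⁻¹)) * (Complex.exp (2 * t ^ 2))⁻¹ := by
    rw [← Complex.exp_neg, ← Complex.exp_add]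
    congr 1
    nth_rewrite 3 4 [← husq]
    field_simp
    ring
  have e2 : Complex.exp ((t * (Complex.sqrt ζ + (Complex.sqrt ζ)⁻¹)) ^ 2) =
      Complex.exp (t ^ 2 * (ζ + ζ⁻¹)) * Complex.exp (2 * t ^ 2) := by
    rw [← Complex.exp_add]
    congr 1
    nth_rewrite 3 4 [← husq]
    field_simp
    ring
  refine HasDerivAt.congr_deriv (f := saddlePrimitive t) h ?_
  rw [e1, e2, Complex.exp_neg (2 * (t : ℂ) ^ 2)]
  have hA := Complex.exp_ne_zero (2 * (t : ℂ) ^ 2)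
  generalize Complex.exp (t ^ 2 * (ζ + ζ⁻¹)) = E at *
  generalize Complex.exp (2 * (t : ℂ) ^ 2) = A at *
  clear h hv hw hE hu e1 e2
  generalize Complex.sqrt ζ = u at *
  subst husq
  field_simp
  ring

theorem norm_exp_saddle (t : ℝ) (ζ : ℂ) :
    ‖Complex.exp (t ^ 2 * (ζ + ζ⁻¹))‖ = Real.exp (t ^ 2 * (ζ + ζ⁻¹).re) := by
  rw [Complex.norm_exp, ← Complex.ofReal_pow, Complex.re_ofReal_mul]

theorem csqrt_re_pos {ζ : ℂ} (hζ : 0 < ζ.re) : 0 < (Complex.sqrt ζ).re := by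
  rw [Complex.sqrt, Complex.cpow_inv_two_re]
  have := norm_nonneg ζ
  exact Real.sqrt_pos.2 (by linarith)

/-- The values of the primitive at the endpoints `1 ± 13 i`. -/
theorem exists_norm_saddlePrimitive_sub_le {σ : ℝ} (hσ : σ ^ 2 = 1) :
    ∃ C : ℝ, 0 < C ∧ ∀ t : ℝ, 1 ≤ t →
      ‖saddlePrimitive t (1 + (13 * σ : ℝ) * Complex.I) -
        1 / (t : ℂ) ^ 2 * ((t - 1 / (2 * t)) * Complex.exp (2 * t ^ 2) *
          (Complex.I * σ * (Real.sqrt Real.pi / 2 : ℝ)))‖ ≤ C * Real.exp (7 / 4 * t ^ 2) := by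
  set ζ : ℂ := 1 + (13 * σ : ℝ) * Complex.I with hζ
  have hre : ζ.re = 1 := by simp [hζ]
  have him : ζ.im = 13 * σ := by simp [hζ]
  have hζ0 : ζ ≠ 0 := by intro h; simp [h] at hre
  have hns : Complex.normSq ζ = 170 := by
    rw [Complex.normSq_apply, hre, him]
    linear_combination 169 * hσ
  have hinv : (ζ⁻¹).re = 1 / 170 := by rw [Complex.inv_re, hre, hns]
  set u := Complex.sqrt ζ with hu
  have hu2 : u ^ 2 = ζ := csqrt_sq ζ
  have hu0 : u ≠ 0 := csqrt_ne_zero hζ0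
  have hure : 0 < u.re := csqrt_re_pos (by rw [hre]; norm_num)
  have huim : 0 < σ * u.im := by
    have h1 : 2 * (u.re * u.im) = 13 * σ := by
      rw [← him, ← hu2, sq, Complex.mul_im]
      ring
    have h2 : 2 * u.re * (σ * u.im) = 13 := by linear_combination σ * h1 + 13 * hσ
    by_contra! h
    nlinarith
  have hw2 : (u - u⁻¹) ^ 2 = ζ + ζ⁻¹ - 2 := by
    rw [← hu2]
    field_simp
    ring
  have hv2 : (u + u⁻¹) ^ 2 = ζ + ζ⁻¹ + 2 := by
    rw [← hu2]
    field_simp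
    ring
  have hwre : ((u - u⁻¹) ^ 2).re = -169 / 170 := by
    rw [hw2, Complex.sub_re, Complex.add_re, hre, hinv]
    norm_num
  have hvre : ((u + u⁻¹) ^ 2).re = 3 + 1 / 170 := by
    rw [hv2, Complex.add_re, Complex.add_re, hre, hinv]
    norm_num
  have hwim : 0 < σ * (u - u⁻¹).im := by
    have h1 : (u - u⁻¹).im = u.im * (1 + (Complex.normSq u)⁻¹) := by
      rw [Complex.sub_im, Complex.inv_im]
      ring
    rw [h1, ← mul_assoc]
    have := Complex.normSq_pos.2 hu0
    positivity
  obtain ⟨C, hC, hCle⟩ := exists_norm_expSqPrimitive_sub_le (by rw [hwre]; norm_num) hσ hwim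
  refine ⟨‖u‖ + C + 2 * ‖u + u⁻¹‖, by positivity, fun t ht => ?_⟩
  have ht0 : 0 < t := by linarith
  have ht2 : 1 ≤ t ^ 2 := one_le_pow₀ ht
  have hW := hCle t ht0.le
  have hV := norm_expSqPrimitive_ray_le ht0.le (ω := u + u⁻¹) (by rw [hvre]; norm_num)
  rw [hwre] at hW
  rw [hvre] at hV
  have hE : ‖Complex.exp (t ^ 2 * (ζ + ζ⁻¹))‖ ≤ Real.exp (7 / 4 * t ^ 2) := by
    rw [norm_exp_saddle, Real.exp_le_exp, Complex.add_re, hre, hinv]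
    nlinarith
  have h1t : 1 / t ≤ 1 := by rw [div_le_one ht0]; exact ht
  have h1t' : 0 < 1 / t := by positivity
  have h12 : 1 / (2 * t) = 1 / t / 2 := by field_simp
  have hm : ‖(t - 1 / (2 * t) : ℂ)‖ ≤ t := by
    rw [show (t - 1 / (2 * t) : ℂ) = ((t - 1 / (2 * t) : ℝ) : ℂ) by push_cast; rfl,
      Complex.norm_real, Real.norm_of_nonneg (by rw [h12]; linarith), h12]
    linarith
  have hp : ‖(t + 1 / (2 * t) : ℂ)‖ ≤ 2 * t := by
    rw [show (t + 1 / (2 * t) : ℂ) = ((t + 1 / (2 * t) : ℝ) : ℂ) by push_cast; rfl,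
      Complex.norm_real, Real.norm_of_nonneg (by positivity), h12]
    linarith
  have hexp : ∀ a : ℝ, ‖Complex.exp ((a * t ^ 2 : ℝ) : ℂ)‖ = Real.exp (a * t ^ 2) := by
    intro a
    rw [← Complex.ofReal_exp, Complex.norm_real, Real.norm_of_nonneg (Real.exp_pos _).le]
  have hA : ‖Complex.exp (2 * (t : ℂ) ^ 2)‖ = Real.exp (2 * t ^ 2) := by
    have := hexp 2
    push_cast at this
    exact this
  have hB : ‖Complex.exp (-(2 * (t : ℂ) ^ 2))‖ = Real.exp (-2 * t ^ 2) := by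
    have := hexp (-2)
    push_cast at this
    rw [← this]
    congr 2
    ring
  set X := Real.exp (7 / 4 * t ^ 2) with hX
  have hT2 : ‖(t - 1 / (2 * t) : ℂ) * Complex.exp (2 * t ^ 2) *
      (expSqPrimitive (t * (u - u⁻¹)) - Complex.I * σ * (Real.sqrt Real.pi / 2 : ℝ))‖ ≤
      t * (C * X) := by
    rw [norm_mul, norm_mul, hA, mul_assoc]
    refine mul_le_mul hm ?_ (by positivity) ht0.le
    calc Real.exp (2 * t ^ 2) * ‖expSqPrimitive (t * (u - u⁻¹)) -
          Complex.I * σ * (Real.sqrt Real.pi / 2 : ℝ)‖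
        ≤ Real.exp (2 * t ^ 2) * (C * Real.exp (-169 / 170 / 2 * t ^ 2)) := by gcongr
      _ = C * Real.exp (2 * t ^ 2 + -169 / 170 / 2 * t ^ 2) := by rw [Real.exp_add]; ring
      _ ≤ C * X := by
        rw [hX]
        gcongr
        nlinarith
  have hT3 : ‖(t + 1 / (2 * t) : ℂ) * Complex.exp (-(2 * t ^ 2)) *
      expSqPrimitive (t * (u + u⁻¹))‖ ≤ 2 * t * (t * ‖u + u⁻¹‖ * X) := by
    rw [norm_mul, norm_mul, hB, mul_assoc]
    refine mul_le_mul hp ?_ (by positivity) (by positivity)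
    calc Real.exp (-2 * t ^ 2) * ‖expSqPrimitive (t * (u + u⁻¹))‖
        ≤ Real.exp (-2 * t ^ 2) * (‖u + u⁻¹‖ * (Real.exp ((3 + 1 / 170) * t ^ 2) * t)) := by gcongr
      _ = t * ‖u + u⁻¹‖ * Real.exp (-2 * t ^ 2 + (3 + 1 / 170) * t ^ 2) := by
        rw [Real.exp_add]; ring
      _ ≤ t * ‖u + u⁻¹‖ * X := by
        rw [hX]
        gcongr
        nlinarith
  have hsub : saddlePrimitive t ζ - 1 / (t : ℂ) ^ 2 *
      ((t - 1 / (2 * t)) * Complex.exp (2 * t ^ 2) *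
        (Complex.I * σ * (Real.sqrt Real.pi / 2 : ℝ))) =
      1 / (t : ℂ) ^ 2 * (u * Complex.exp (t ^ 2 * (ζ + ζ⁻¹)) +
        (t - 1 / (2 * t) : ℂ) * Complex.exp (2 * t ^ 2) *
          (expSqPrimitive (t * (u - u⁻¹)) - Complex.I * σ * (Real.sqrt Real.pi / 2 : ℝ)) -
        (t + 1 / (2 * t) : ℂ) * Complex.exp (-(2 * t ^ 2)) *
          expSqPrimitive (t * (u + u⁻¹))) := by
    rw [saddlePrimitive, ← hu]
    ring
  rw [hsub, norm_mul]
  have hn : ‖(1 / (t : ℂ) ^ 2)‖ = 1 / t ^ 2 := by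
    rw [norm_div, norm_pow, Complex.norm_real, norm_one, Real.norm_of_nonneg ht0.le]
  have htle : t ≤ t ^ 2 := by nlinarith
  have hX0 : 0 < X := Real.exp_pos _
  rw [hn, one_div, inv_mul_le_iff₀ (by positivity)]
  refine (norm_sub_le _ _).trans ((add_le_add ((norm_add_le _ _).trans
    (add_le_add ((norm_mul _ _).trans_le (mul_le_mul_of_nonneg_left hE (norm_nonneg u))) hT2))
    hT3).trans ?_)
  have a1 : ‖u‖ * X ≤ t ^ 2 * (‖u‖ * X) := le_mul_of_one_le_left (by positivity) ht2
  have a2 : t * (C * X) ≤ t ^ 2 * (C * X) := by gcongr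
  nlinarith

theorem continuous_saddle (a : ℂ) : Continuous fun τ : ℝ => Complex.sqrt (1 + τ * Complex.I) *
    Complex.exp (a * ((1 + τ * Complex.I) + (1 + τ * Complex.I)⁻¹)) := by
  rw [continuous_iff_continuousAt]
  intro τ
  have hre : 0 < (1 + τ * Complex.I).re := by simp
  have hne : (1 + τ * Complex.I) ≠ 0 := by intro h; simp [h] at hre
  have h1 : ContinuousAt (fun τ : ℝ => (1 + τ * Complex.I)) τ := by fun_prop
  have h2 := (hasDerivAt_csqrt hre).continuousAt
  exact (ContinuousAt.comp (f := fun τ : ℝ => (1 + τ * Complex.I)) h2 h1).mul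
    ((continuousAt_const.mul (h1.add (h1.inv₀ hne))).cexp)

/-- The saddle point integral, with an exponentially small relative error. -/
theorem exists_norm_saddle_integral_sub_le :
    ∃ C : ℝ, 0 < C ∧ ∀ t : ℝ, 1 ≤ t →
      ‖(∫ τ in (-13 : ℝ)..13, Complex.sqrt (1 + τ * Complex.I) *
          Complex.exp (t ^ 2 * ((1 + τ * Complex.I) + (1 + τ * Complex.I)⁻¹))) -
        ((Real.sqrt Real.pi * (1 - 1 / (2 * t ^ 2)) / t * Real.exp (2 * t ^ 2) : ℝ) : ℂ)‖ ≤
        C * Real.exp (7 / 4 * t ^ 2) := by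
  obtain ⟨C₁, hC₁, h₁⟩ := exists_norm_saddlePrimitive_sub_le (σ := 1) (by norm_num)
  obtain ⟨C₂, hC₂, h₂⟩ := exists_norm_saddlePrimitive_sub_le (σ := -1) (by norm_num)
  refine ⟨C₁ + C₂, by positivity, fun t ht => ?_⟩
  have ht0 : 0 < t := by linarith
  have ht0' : (t : ℂ) ≠ 0 := by exact_mod_cast ht0.ne'
  have hline : ∀ τ : ℝ, HasDerivAt (fun τ : ℝ => -Complex.I *
      saddlePrimitive t (1 + τ * Complex.I))
      (Complex.sqrt (1 + τ * Complex.I) *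
          Complex.exp (t ^ 2 * ((1 + τ * Complex.I) + (1 + τ * Complex.I)⁻¹))) τ := by
    intro τ
    have h1 : HasDerivAt (fun τ : ℂ => 1 + τ * Complex.I) Complex.I (τ : ℂ) := by
      simpa using ((hasDerivAt_id (τ : ℂ)).mul_const Complex.I).const_add 1
    have h2 := (((hasDerivAt_saddlePrimitive ht0 (ζ := 1 + τ * Complex.I) (by simp)).comp
      (τ : ℂ) h1).const_mul (-Complex.I)).comp_ofReal
    refine h2.congr_deriv ?_
    linear_combination (-(Complex.sqrt (1 + τ * Complex.I) *
          Complex.exp (t ^ 2 * ((1 + τ * Complex.I) + (1 + τ * Complex.I)⁻¹)))) * Complex.I_sq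
  rw [intervalIntegral.integral_eq_sub_of_hasDerivAt (fun τ _ => hline τ)
    ((continuous_saddle _).intervalIntegrable _ _)]
  have e₁ := h₁ t ht
  have e₂ := h₂ t ht
  rw [mul_one] at e₁
  rw [show (13 * (-1) : ℝ) = -13 by norm_num] at e₂
  generalize saddlePrimitive t (1 + (13 : ℝ) * Complex.I) = H₁ at *
  generalize saddlePrimitive t (1 + (-13 : ℝ) * Complex.I) = H₂ at *
  have hid : -Complex.I * H₁ - -Complex.I * H₂ -
      ((Real.sqrt Real.pi * (1 - 1 / (2 * t ^ 2)) / t * Real.exp (2 * t ^ 2) : ℝ) : ℂ) =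
      -Complex.I * (H₁ - 1 / (t : ℂ) ^ 2 * ((t - 1 / (2 * t)) * Complex.exp (2 * t ^ 2) *
          (Complex.I * (1 : ℝ) * (Real.sqrt Real.pi / 2 : ℝ)))) +
      Complex.I * (H₂ - 1 / (t : ℂ) ^ 2 * ((t - 1 / (2 * t)) * Complex.exp (2 * t ^ 2) *
          (Complex.I * (-1 : ℝ) * (Real.sqrt Real.pi / 2 : ℝ)))) := by
    push_cast
    field_simp
    linear_combination (-2 * Complex.exp (2 * (t : ℂ) ^ 2) * (Real.sqrt Real.pi : ℂ) *
      (2 * (t : ℂ) ^ 2 - 1)) * Complex.I_sq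
  rw [hid]
  refine (norm_add_le _ _).trans ?_
  rw [norm_mul, norm_mul, norm_neg, Complex.norm_I, one_mul, one_mul, add_mul]
  exact add_le_add e₁ e₂

/-! ### The Hardy–Ramanujan formula -/

/-- The integrand `P(e^{-z}) e^{nz}`, `z = x + i θ`, of the Cauchy integral for `p(n)`. -/
noncomputable def cauchyIntegrand (n : ℕ) (x θ : ℝ) : ℂ :=
  partitionSeries (Complex.exp (-(x + θ * Complex.I))) * Complex.exp (n * (x + θ * Complex.I))

theorem integral_exp_int_mul (k : ℤ) :
    ∫ θ in (-Real.pi)..Real.pi, Complex.exp (k * (θ * Complex.I)) =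
      if k = 0 then (2 * Real.pi : ℂ) else 0 := by
  split_ifs with hk
  · simp [hk]
    ring
  · have hk' : (k : ℂ) * Complex.I ≠ 0 := mul_ne_zero (by exact_mod_cast hk) Complex.I_ne_zero
    have h := integral_exp_mul_complex (a := -Real.pi) (b := Real.pi) hk'
    have e : ∀ θ : ℝ, (k : ℂ) * (θ * Complex.I) = k * Complex.I * θ := fun θ => by ring
    simp only [e]
    rw [h, div_eq_zero_iff]
    left
    rw [sub_eq_zero, Complex.exp_eq_exp_iff_exists_int]
    exact ⟨k, by push_cast; ring⟩

theorem norm_exp_neg_line (x θ : ℝ) :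
    ‖Complex.exp (-(x + θ * Complex.I))‖ = Real.exp (-x) := by
  simp [Complex.norm_exp]

theorem continuous_cauchyIntegrand (n : ℕ) {x : ℝ} (hx : 0 < x) :
    Continuous (cauchyIntegrand n x) := by
  refine Continuous.mul ?_ (by fun_prop)
  refine continuous_tsum (u := fun m => (numPartitions m : ℝ) * Real.exp (-x) ^ m)
    (fun m => by fun_prop)
    (summable_numPartitions (Real.exp_pos _).le (by simpa using hx)) fun m θ => ?_
  rw [norm_mul, norm_pow, norm_exp_neg_line, Complex.norm_natCast]

/-- Cauchy's coefficient formula on the circle of radius `exp (-x)`. -/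
theorem integral_cauchyIntegrand (n : ℕ) {x : ℝ} (hx : 0 < x) :
    ∫ θ in (-Real.pi)..Real.pi, cauchyIntegrand n x θ = 2 * Real.pi * numPartitions n := by
  have hs := summable_numPartitions (Real.exp_pos (-x)).le (by simpa using hx)
  let f : ℕ → ℝ → ℂ := fun m θ => (numPartitions m : ℂ) *
    Complex.exp (-(x + θ * Complex.I)) ^ m * Complex.exp (n * (x + θ * Complex.I))
  have hnorm : ∀ m θ, ‖f m θ‖ =
      (numPartitions m : ℝ) * Real.exp (-x) ^ m * Real.exp (n * x) := by
    intro m θ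
    simp only [f]
    rw [norm_mul, norm_mul, norm_pow, norm_exp_neg_line, Complex.norm_natCast, Complex.norm_exp]
    simp
  have h := intervalIntegral.hasSum_integral_of_dominated_convergence (μ := volume)
    (a := -Real.pi) (b := Real.pi) (F := f) (f := cauchyIntegrand n x)
    (fun m _ => (numPartitions m : ℝ) * Real.exp (-x) ^ m * Real.exp (n * x))
    (fun m => (by fun_prop : Continuous (f m)).aestronglyMeasurable)
    (fun m => Eventually.of_forall fun θ _ => (hnorm m θ).le)
    (Eventually.of_forall fun θ _ => hs.mul_right _)
    (intervalIntegrable_const)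
    (Eventually.of_forall fun θ _ => by
      have hq : ‖Complex.exp (-(x + θ * Complex.I))‖ < 1 := by
        rw [norm_exp_neg_line]
        simpa using hx
      exact ((summable_norm_partitionSeries hq).of_norm.hasSum).mul_right _)
  have hterm : ∀ m, ∫ θ in (-Real.pi)..Real.pi, f m θ =
      if m = n then 2 * Real.pi * (numPartitions n : ℂ) else 0 := by
    intro m
    have e : ∀ θ, f m θ = (numPartitions m : ℂ) * Complex.exp ((n - m) * x) *
        Complex.exp (((n : ℤ) - (m : ℤ) : ℤ) * (θ * Complex.I)) := by
      intro θ
      simp only [f]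
      rw [← Complex.exp_nat_mul, mul_assoc, mul_assoc, ← Complex.exp_add, ← Complex.exp_add]
      congr 2
      push_cast
      ring
    simp only [e]
    rw [intervalIntegral.integral_const_mul, integral_exp_int_mul]
    by_cases hmn : m = n
    · subst hmn
      simp
      ring
    · rw [if_neg hmn, if_neg (by omega), mul_zero]
  simp only [hterm] at h
  exact h.unique (hasSum_ite_eq n _)

theorem csqrt_real_mul {a : ℝ} (ha : 0 < a) (ζ : ℂ) :
    Complex.sqrt (a * ζ) = (Real.sqrt a : ℝ) * Complex.sqrt ζ := by
  rcases eq_or_ne ζ 0 with rfl | hζ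
  · simp
  have ha' : (a : ℂ) ≠ 0 := by exact_mod_cast ha.ne'
  rw [Complex.sqrt, Complex.sqrt, Complex.cpow_def_of_ne_zero hζ,
    Complex.cpow_def_of_ne_zero (mul_ne_zero ha' hζ), Complex.log_ofReal_mul ha hζ, add_mul,
    Complex.exp_add, Real.sqrt_eq_rpow, Real.rpow_def_of_pos ha]
  push_cast
  norm_num

/-- The Cauchy integrand in the scaled variable `ζ = z / x`, where `x` is the saddle point. -/
theorem cauchyIntegrand_scaled {n : ℕ} {N x : ℝ} (hN : 0 < N)
    (hN2 : N ^ 2 = Real.pi ^ 2 / 6 * (n - 1 / 24)) (hx : x = Real.pi ^ 2 / 6 / N) (τ : ℝ) :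
    cauchyIntegrand n x (x * τ) = (Real.sqrt (x / (2 * Real.pi)) : ℝ) *
      (Complex.sqrt (1 + τ * Complex.I) *
        Complex.exp (N * ((1 + τ * Complex.I) + (1 + τ * Complex.I)⁻¹))) *
      partitionSeries (Complex.exp (-(24 * N * (1 + τ * Complex.I)⁻¹))) := by
  have hpi := Real.pi_pos
  have hx0 : 0 < x := by rw [hx]; positivity
  set ζ : ℂ := 1 + τ * Complex.I with hζ
  have hre : ζ.re = 1 := by simp [hζ]
  have hζ0 : ζ ≠ 0 := by intro h; simp [h] at hre
  have hz : (x : ℂ) + (x * τ : ℝ) * Complex.I = x * ζ := by rw [hζ]; push_cast; ring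
  have hpi' : (Real.pi : ℂ) ≠ 0 := by exact_mod_cast hpi.ne'
  have hN' : (N : ℂ) ≠ 0 := by exact_mod_cast hN.ne'
  have hxC : (x : ℂ) = Real.pi ^ 2 / 6 / N := by rw [hx]; push_cast; rfl
  have hN2C : (N : ℂ) ^ 2 = Real.pi ^ 2 / 6 * (n - 1 / 24) := by
    have := congrArg (fun r : ℝ => (r : ℂ)) hN2
    push_cast at this
    exact this
  have hsq : (x : ℂ) * ζ / (2 * Real.pi) = ((x / (2 * Real.pi) : ℝ) : ℂ) * ζ := by
    push_cast
    ring
  rw [cauchyIntegrand, hz, partitionSeries_modular (by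
    rw [Complex.re_ofReal_mul, hre, mul_one]; exact hx0), hsq, csqrt_real_mul (by positivity)]
  have hq : 4 * (Real.pi : ℂ) ^ 2 / (x * ζ) = 24 * N * ζ⁻¹ := by
    rw [hxC]
    field_simp
    norm_num
  have hexp : Complex.exp (Real.pi ^ 2 / (6 * (x * ζ)) - x * ζ / 24) *
      Complex.exp (n * (x * ζ)) = Complex.exp (N * (ζ + ζ⁻¹)) := by
    rw [← Complex.exp_add]
    congr 1
    have h1 : (Real.pi : ℂ) ^ 2 / (6 * (x * ζ)) = N * ζ⁻¹ := by
      rw [hxC]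
      field_simp
    have h2 : (x : ℂ) * (n - 1 / 24) = N := by
      rw [hxC, div_mul_eq_mul_div, ← hN2C]
      field_simp
    rw [h1]
    linear_combination ζ * h2
  rw [hq, ← hexp]
  ring

theorem norm_exp_saddle_line_le {N : ℝ} (hN : 0 ≤ N) (τ : ℝ) :
    ‖Complex.exp (N * ((1 + τ * Complex.I) + (1 + τ * Complex.I)⁻¹))‖ ≤ Real.exp (2 * N) := by
  rw [Complex.norm_exp, Real.exp_le_exp, Complex.re_ofReal_mul, Complex.add_re, Complex.inv_re,
    Complex.normSq_apply]
  simp only [Complex.add_re, Complex.one_re, Complex.re_ofReal_mul, Complex.I_re, Complex.add_im,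
    Complex.one_im, Complex.im_ofReal_mul, Complex.I_im]
  have : (1 + τ * 0) / ((1 + τ * 0) * (1 + τ * 0) + (0 + τ * 1) * (0 + τ * 1)) ≤ 1 := by
    rw [div_le_one (by nlinarith [sq_nonneg τ])]
    nlinarith [sq_nonneg τ]
  nlinarith

theorem norm_dual_nome (N τ : ℝ) :
    ‖Complex.exp (-(24 * N * (1 + τ * Complex.I)⁻¹))‖ = Real.exp (-(24 * N / (1 + τ ^ 2))) := by
  rw [Complex.norm_exp]
  congr 1
  rw [Complex.neg_re, show (24 * N : ℂ) = ((24 * N : ℝ) : ℂ) by push_cast; rfl,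
    Complex.re_ofReal_mul, Complex.inv_re, Complex.normSq_apply]
  simp
  ring_nf

/-- The leading term of the Hardy–Ramanujan formula up to the constant factor `mainConst`, in terms
of `N = π √((n - 1/24) / 6)`. -/
noncomputable def mainTerm (N : ℝ) : ℝ := (1 - 1 / (2 * N)) / N ^ 2 * Real.exp (2 * N)

/-- The positive constant with which `mainTerm` enters the Hardy–Ramanujan formula. -/
noncomputable def mainConst : ℝ :=
  Real.pi ^ 2 / 6 / (2 * Real.pi) * Real.sqrt (Real.pi ^ 2 / 6 / (2 * Real.pi)) * Real.sqrt Real.pi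

theorem mainConst_pos : 0 < mainConst := by
  have := Real.pi_pos
  rw [mainConst]
  positivity

theorem pi_sq_div_six_bounds : 1.6 < Real.pi ^ 2 / 6 ∧ Real.pi ^ 2 / 6 < 1.66 := by
  have h1 := Real.pi_gt_d2
  have h2 := Real.pi_lt_d2
  constructor <;> nlinarith

/-- The Hardy–Ramanujan formula with an exponentially small relative error. -/
theorem exists_abs_numPartitions_sub_le :
    ∃ C : ℝ, 0 < C ∧ ∀ (n : ℕ) (N : ℝ), 8 ≤ N → N ^ 2 = Real.pi ^ 2 / 6 * (n - 1 / 24) →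
      |(numPartitions n : ℝ) - mainConst * mainTerm N| ≤ C * Real.exp ((2 - 1 / 64) * N) := by
  obtain ⟨C₁, hC₁, h₁⟩ := exists_norm_partitionSeries_sub_one_le
  obtain ⟨C₂, hC₂, h₂⟩ := exists_norm_saddle_integral_sub_le
  -- The three summands come from replacing the dual series by `1` on an interval of length `26`,
  -- from the saddle point integral, and from the minor arcs.
  refine ⟨26 * (4 * C₁) + C₂ + 2 * Real.pi * (1 + C₁), by have := Real.pi_pos; positivity,
    fun n N hN8 hN2 => ?_⟩
  have hN : 0 < N := by linarith
  have hpi := Real.pi_pos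
  have hpi3 := Real.pi_gt_three
  obtain ⟨hA1, hA2⟩ := pi_sq_div_six_bounds
  set A := Real.pi ^ 2 / 6 with hA
  obtain ⟨x, hx⟩ : ∃ x, x = A / N := ⟨_, rfl⟩
  have hx0 : 0 < x := by rw [hx]; positivity
  have hxle : x ≤ 0.21 := by
    rw [hx, div_le_iff₀ hN]
    nlinarith
  set Y := Real.exp ((2 - 1 / 64) * N) with hY
  have hY0 : 0 < Y := Real.exp_pos _
  set S := Real.sqrt (x / (2 * Real.pi)) with hS
  have hS0 : 0 ≤ S := Real.sqrt_nonneg _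
  have hS1 : S ≤ 1 := by
    rw [hS, Real.sqrt_le_one, div_le_one (by positivity)]
    linarith
  let t := Real.sqrt N
  have ht2 : t ^ 2 = N := Real.sq_sqrt hN.le
  have ht1 : 1 ≤ t := by
    rw [Real.one_le_sqrt]
    linarith
  have ht2C : (t : ℂ) ^ 2 = N := by exact_mod_cast ht2
  let g : ℝ → ℂ := fun τ => Complex.sqrt (1 + τ * Complex.I) *
        Complex.exp (N * ((1 + τ * Complex.I) + (1 + τ * Complex.I)⁻¹))
  have hFc := continuous_cauchyIntegrand n hx0
  have hdual : ∀ τ : ℝ, |τ| ≤ 13 →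
      ‖partitionSeries (Complex.exp (-(24 * N * (1 + τ * Complex.I)⁻¹))) - 1‖ ≤
        C₁ * Real.exp (-(1 / 64 * N)) := by
    intro τ hτ
    have hτ2 : τ ^ 2 ≤ 169 := by
      have := sq_le_sq' (by linarith [neg_abs_le τ]) ((le_abs_self τ).trans hτ)
      linarith
    have hle : 24 / 170 * N ≤ 24 * N / (1 + τ ^ 2) := by
      rw [le_div_iff₀ (by positivity)]
      nlinarith
    have hnome := norm_dual_nome N τ
    refine (h₁ _ ?_).trans ?_
    · rw [hnome]
      calc Real.exp (-(24 * N / (1 + τ ^ 2))) ≤ Real.exp (-Real.log 2) := by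
            rw [Real.exp_le_exp]
            linarith [Real.log_two_lt_d9]
        _ = 1 / 2 := by rw [Real.exp_neg, Real.exp_log two_pos]; norm_num
    · rw [hnome]
      gcongr
      linarith
  -- On the central arc `|θ| ≤ 13 x`, both `7 / 4` and `2 - 24 / 170` are below `2 - 1 / 64`.
  have hg : ‖(∫ τ in (-13 : ℝ)..13, g τ) -
      ((Real.sqrt Real.pi * (1 - 1 / (2 * t ^ 2)) / t * Real.exp (2 * t ^ 2) : ℝ) : ℂ)‖ ≤
      C₂ * Y := by
    have := h₂ t ht1
    rw [ht2C] at this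
    refine this.trans ?_
    rw [hY, ht2]
    gcongr
    norm_num
  have hcentral : ‖∫ τ in (-13 : ℝ)..13, (cauchyIntegrand n x (x * τ) - S * g τ)‖ ≤
      26 * (4 * C₁) * Y := by
    have hb : ∀ τ ∈ Set.uIoc (-13 : ℝ) 13,
        ‖cauchyIntegrand n x (x * τ) - S * g τ‖ ≤ 4 * C₁ * Y := by
      intro τ hτ
      rw [Set.uIoc_of_le (by norm_num)] at hτ
      have hτ' : |τ| ≤ 13 := abs_le.2 ⟨hτ.1.le, hτ.2⟩
      have hsqrt : ‖Complex.sqrt (1 + τ * Complex.I)‖ ≤ 4 := by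
        have h1 : ‖Complex.sqrt (1 + τ * Complex.I)‖ ^ 2 ≤ 4 ^ 2 := by
          rw [← norm_pow, csqrt_sq]
          refine (norm_add_le _ _).trans ?_
          rw [norm_one, norm_mul, Complex.norm_I, Complex.norm_real, Real.norm_eq_abs]
          linarith
        exact abs_le_of_sq_le_sq' h1 (by norm_num) |>.2
      rw [cauchyIntegrand_scaled hN hN2 hx]
      have e : (S : ℂ) * g τ * partitionSeries (Complex.exp (-(24 * N * (1 + τ * Complex.I)⁻¹))) -
          S * g τ = S * g τ *
          (partitionSeries (Complex.exp (-(24 * N * (1 + τ * Complex.I)⁻¹))) - 1) := by ring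
      rw [e, norm_mul, norm_mul, norm_mul, Complex.norm_real, Real.norm_of_nonneg hS0]
      calc S * (‖Complex.sqrt (1 + τ * Complex.I)‖ *
            ‖Complex.exp (N * ((1 + τ * Complex.I) + (1 + τ * Complex.I)⁻¹))‖) *
            ‖partitionSeries (Complex.exp (-(24 * N * (1 + τ * Complex.I)⁻¹))) - 1‖
          ≤ 1 * (4 * Real.exp (2 * N)) * (C₁ * Real.exp (-(1 / 64 * N))) := by
            have := norm_exp_saddle_line_le hN.le τ
            have := hdual τ hτ'
            gcongr
        _ = 4 * C₁ * Real.exp (2 * N + -(1 / 64 * N)) := by rw [Real.exp_add]; ring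
        _ = 4 * C₁ * Y := by rw [hY]; congr 2; ring
    refine (intervalIntegral.norm_integral_le_of_norm_le_const hb).trans_eq ?_
    norm_num
    ring
  -- On the minor arcs, the saving `1 / (32 x)` is at least `N / 64` because `π² / 6 ≤ 2`.
  have hminor : ∀ θ : ℝ, 13 * x ≤ |θ| → |θ| ≤ Real.pi →
      ‖cauchyIntegrand n x θ‖ ≤ (1 + C₁) * Y := by
    intro θ h1 h2
    have h3 := norm_partitionSeries_minor hx0 (by linarith) h1 h2
    have h4 : ‖cauchyIntegrand n x θ‖ ≤
        Real.exp (-1 / (32 * x)) * ‖cauchyIntegrand n x (x * 0)‖ := by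
      rw [cauchyIntegrand, cauchyIntegrand, norm_mul, norm_mul, ← mul_assoc]
      have e1 : ‖Complex.exp (n * (x + θ * Complex.I))‖ =
          ‖Complex.exp (n * (x + (x * 0 : ℝ) * Complex.I))‖ := by
        simp [Complex.norm_exp]
      rw [e1]
      gcongr
      simpa using h3
    have h5 : ‖cauchyIntegrand n x (x * 0)‖ ≤ Real.exp (2 * N) * (1 + C₁) := by
      rw [cauchyIntegrand_scaled hN hN2 hx, norm_mul, norm_mul, norm_mul, Complex.norm_real,
        Real.norm_of_nonneg hS0]
      have h6 := norm_exp_saddle_line_le hN.le 0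
      have h7 : ‖Complex.sqrt (1 + (0 : ℝ) * Complex.I)‖ = 1 := by simp
      have h8 : ‖partitionSeries (Complex.exp (-(24 * N * (1 + (0 : ℝ) * Complex.I)⁻¹)))‖ ≤
          1 + C₁ := by
        have h9 := hdual 0 (by norm_num)
        have h10 : Real.exp (-(1 / 64 * N)) ≤ 1 := by
          rw [Real.exp_le_one_iff]
          linarith
        have h11 := norm_sub_norm_le
          (partitionSeries (Complex.exp (-(24 * N * (1 + (0 : ℝ) * Complex.I)⁻¹)))) 1
        rw [norm_one] at h11
        nlinarith
      rw [h7, one_mul]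
      calc S * ‖Complex.exp (N * ((1 + (0 : ℝ) * Complex.I) + (1 + (0 : ℝ) * Complex.I)⁻¹))‖ *
            ‖partitionSeries (Complex.exp (-(24 * N * (1 + (0 : ℝ) * Complex.I)⁻¹)))‖
          ≤ 1 * Real.exp (2 * N) * (1 + C₁) := by gcongr
        _ = _ := by rw [one_mul]
    have h12 : -1 / (32 * x) ≤ -(1 / 64 * N) := by
      have : -1 / (32 * x) = -(N / (32 * A)) := by rw [hx]; field_simp
      rw [this, neg_le_neg_iff, le_div_iff₀ (by positivity)]
      nlinarith
    calc ‖cauchyIntegrand n x θ‖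
        ≤ Real.exp (-(1 / 64 * N)) * (Real.exp (2 * N) * (1 + C₁)) := by
          refine h4.trans ?_
          gcongr
      _ = (1 + C₁) * Real.exp (-(1 / 64 * N) + 2 * N) := by rw [Real.exp_add]; ring
      _ = (1 + C₁) * Y := by rw [hY]; congr 2; ring
  have h13 : 13 * x ≤ Real.pi := by linarith
  have hright : ‖∫ θ in (13 * x)..Real.pi, cauchyIntegrand n x θ‖ ≤ (1 + C₁) * Y * Real.pi := by
    refine (intervalIntegral.norm_integral_le_of_norm_le_const fun θ hθ => ?_).trans
      (mul_le_mul_of_nonneg_left (b := |Real.pi - 13 * x|) ?_ (by positivity))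
    · rw [Set.uIoc_of_le h13] at hθ
      have h0 : 0 ≤ θ := by linarith [hθ.1]
      exact hminor θ (by rw [abs_of_nonneg h0]; exact hθ.1.le)
        (by rw [abs_of_nonneg h0]; exact hθ.2)
    · rw [abs_of_nonneg (by linarith)]
      linarith
  have hleft : ‖∫ θ in (-Real.pi)..(-(13 * x)), cauchyIntegrand n x θ‖ ≤
      (1 + C₁) * Y * Real.pi := by
    refine (intervalIntegral.norm_integral_le_of_norm_le_const fun θ hθ => ?_).trans
      (mul_le_mul_of_nonneg_left (b := |-(13 * x) - -Real.pi|) ?_ (by positivity))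
    · rw [Set.uIoc_of_le (by linarith)] at hθ
      have h0 : θ ≤ 0 := by linarith [hθ.2]
      exact hminor θ (by rw [abs_of_nonpos h0]; linarith [hθ.2])
        (by rw [abs_of_nonpos h0]; linarith [hθ.1])
    · rw [abs_of_nonneg (by linarith)]
      linarith
  have hsplit : (2 * Real.pi * numPartitions n : ℂ) =
      (∫ θ in (-Real.pi)..(-(13 * x)), cauchyIntegrand n x θ) +
      x * (∫ τ in (-13 : ℝ)..13, cauchyIntegrand n x (x * τ)) +
      ∫ θ in (13 * x)..Real.pi, cauchyIntegrand n x θ := by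
    have hscale : (x : ℂ) * (∫ τ in (-13 : ℝ)..13, cauchyIntegrand n x (x * τ)) =
        ∫ θ in (-(13 * x))..(13 * x), cauchyIntegrand n x θ := by
      have := intervalIntegral.smul_integral_comp_mul_left (a := -13) (b := 13)
        (cauchyIntegrand n x) x
      rw [Complex.real_smul] at this
      rw [this]
      congr 1 <;> ring
    rw [← integral_cauchyIntegrand n hx0, hscale,
      intervalIntegral.integral_add_adjacent_intervals (hFc.intervalIntegrable _ _)
        (hFc.intervalIntegrable _ _),
      intervalIntegral.integral_add_adjacent_intervals (hFc.intervalIntegrable _ _)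
        (hFc.intervalIntegrable _ _)]
  set M : ℝ := Real.sqrt Real.pi * (1 - 1 / (2 * t ^ 2)) / t * Real.exp (2 * t ^ 2) with hM
  have hgc : Continuous fun τ : ℝ => (S : ℂ) * g τ := continuous_const.mul (continuous_saddle N)
  have hFc' : Continuous fun τ : ℝ => cauchyIntegrand n x (x * τ) :=
    hFc.comp (continuous_const.mul continuous_id)
  have hmain : x * S * M = 2 * Real.pi * (mainConst * mainTerm N) := by
    have ht0 : 0 < t := by linarith
    have hS' : S = Real.sqrt (A / (2 * Real.pi)) / t := by
      rw [hS, hx, ← Real.sqrt_div' _ hN.le]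
      congr 1
      field_simp
    rw [hM, ht2, hS', hx, mainConst, mainTerm, ← hA]
    field_simp
    rw [ht2]
  have hdecomp : ((2 * Real.pi * (numPartitions n - mainConst * mainTerm N) : ℝ) : ℂ) =
      (∫ θ in (-Real.pi)..(-(13 * x)), cauchyIntegrand n x θ) +
      x * (∫ τ in (-13 : ℝ)..13, (cauchyIntegrand n x (x * τ) - S * g τ)) +
      (x * S : ℝ) * ((∫ τ in (-13 : ℝ)..13, g τ) - (M : ℝ)) +
      ∫ θ in (13 * x)..Real.pi, cauchyIntegrand n x θ := by
    rw [intervalIntegral.integral_sub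
      (hFc'.intervalIntegrable _ _)
      (hgc.intervalIntegrable _ _), intervalIntegral.integral_const_mul, mul_sub, ← hmain]
    push_cast
    linear_combination hsplit
  have hnorm := congrArg norm hdecomp
  rw [Complex.norm_real, Real.norm_eq_abs, abs_mul, abs_of_pos (by positivity : 0 < 2 * Real.pi)]
    at hnorm
  have hxS : x * S ≤ 1 := by nlinarith
  have hbound : ‖(∫ θ in (-Real.pi)..(-(13 * x)), cauchyIntegrand n x θ) +
      x * (∫ τ in (-13 : ℝ)..13, (cauchyIntegrand n x (x * τ) - S * g τ)) +
      (x * S : ℝ) * ((∫ τ in (-13 : ℝ)..13, g τ) - (M : ℝ)) +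
      ∫ θ in (13 * x)..Real.pi, cauchyIntegrand n x θ‖ ≤
      (1 + C₁) * Y * Real.pi + 1 * (26 * (4 * C₁) * Y) + 1 * (C₂ * Y) +
        (1 + C₁) * Y * Real.pi := by
    refine (norm_add_le _ _).trans (add_le_add ((norm_add_le _ _).trans (add_le_add
      ((norm_add_le _ _).trans (add_le_add hleft ?_)) ?_)) hright)
    · rw [norm_mul, Complex.norm_real, Real.norm_of_nonneg hx0.le]
      exact mul_le_mul (by linarith) hcentral (norm_nonneg _) zero_le_one
    · rw [norm_mul, Complex.norm_real, Real.norm_of_nonneg (by positivity)]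
      exact mul_le_mul hxS hg (norm_nonneg _) zero_le_one
  rw [← hnorm] at hbound
  have habs := abs_nonneg ((numPartitions n : ℝ) - mainConst * mainTerm N)
  calc |(numPartitions n : ℝ) - mainConst * mainTerm N|
      ≤ 2 * Real.pi * |(numPartitions n : ℝ) - mainConst * mainTerm N| :=
        le_mul_of_one_le_left habs (by linarith)
    _ ≤ _ := hbound
    _ = _ := by ring

/-! ### The expansion of the ratio -/

theorem pow_five_mul_exp_neg_le {N : ℝ} (hN : 0 ≤ N) :
    N ^ 5 * Real.exp (-(N / 64)) ≤ 120 * 64 ^ 5 := by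
  have h := Real.pow_div_factorial_le_exp (N / 64) (by positivity) 5
  rw [Real.exp_neg, ← div_eq_mul_inv, div_le_iff₀ (Real.exp_pos _)]
  have : (Nat.factorial 5 : ℝ) = 120 := by norm_num [Nat.factorial]
  rw [this, div_pow, div_div, div_le_iff₀ (by positivity)] at h
  linarith

theorem mainTerm_pos {N : ℝ} (hN : 1 ≤ N) : 0 < mainTerm N := by
  have h : 1 / (2 * N) ≤ 1 / 2 := by
    rw [div_le_div_iff₀ (by linarith) two_pos]
    linarith
  have : 0 < 1 - 1 / (2 * N) := by linarith
  rw [mainTerm]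
  positivity

/-- The relative error in the Hardy–Ramanujan formula, weakened to a power of `N`. -/
theorem exists_abs_numPartitions_div_sub_one_le :
    ∃ K : ℝ, 0 < K ∧ ∀ (n : ℕ) (N : ℝ), 8 ≤ N → N ^ 2 = Real.pi ^ 2 / 6 * (n - 1 / 24) →
      |(numPartitions n : ℝ) / (mainConst * mainTerm N) - 1| ≤ K / N ^ 3 := by
  obtain ⟨C, hC, h⟩ := exists_abs_numPartitions_sub_le
  have hκ := mainConst_pos
  refine ⟨2 * C / mainConst * (120 * 64 ^ 5), by positivity, fun n N hN8 hN2 => ?_⟩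
  have hN : 0 < N := by linarith
  have hm := mainTerm_pos (N := N) (by linarith)
  have hmain : Real.exp (2 * N) ≤ 2 * N ^ 2 * mainTerm N := by
    have h1 : 1 / (2 * N) ≤ 1 / 2 := by
      rw [div_le_div_iff₀ (by linarith) two_pos]
      linarith
    have h2 : 2 * N ^ 2 * mainTerm N = 2 * (1 - 1 / (2 * N)) * Real.exp (2 * N) := by
      rw [mainTerm]
      field_simp
    rw [h2]
    nlinarith [Real.exp_pos (2 * N)]
  rw [div_sub_one (by positivity), abs_div, abs_of_pos (by positivity : 0 < mainConst * mainTerm N),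
    div_le_div_iff₀ (by positivity) (by positivity)]
  calc |(numPartitions n : ℝ) - mainConst * mainTerm N| * N ^ 3
      ≤ C * Real.exp ((2 - 1 / 64) * N) * N ^ 3 := by
        gcongr
        exact h n N hN8 hN2
    _ = C * Real.exp (2 * N) * Real.exp (-(N / 64)) * N ^ 3 := by
        have e : Real.exp ((2 - 1 / 64) * N) = Real.exp (2 * N) * Real.exp (-(N / 64)) := by
          rw [← Real.exp_add]
          congr 1
          ring
        rw [e]
        ring
    _ ≤ C * (2 * N ^ 2 * mainTerm N) * Real.exp (-(N / 64)) * N ^ 3 := by gcongr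
    _ = 2 * C * mainTerm N * (N ^ 5 * Real.exp (-(N / 64))) := by ring
    _ ≤ 2 * C * mainTerm N * (120 * 64 ^ 5) :=
        mul_le_mul_of_nonneg_left (pow_five_mul_exp_neg_le hN.le) (by positivity)
    _ = _ := by field_simp

theorem tendsto_one_div_sqrt : Tendsto (fun n : ℕ => 1 / Real.sqrt n) atTop (nhds 0) := by
  simpa [Pi.inv_def] using
    (Real.tendsto_sqrt_atTop.comp tendsto_natCast_atTop_atTop).inv_tendsto_atTop

/-- Two factors known up to `O(e)` have their product known up to `O(e)`. -/
theorem isBigO_mul_sub_mul {f g a b e : ℕ → ℝ} (hf : (fun n => f n - a n) =O[atTop] e)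
    (hg : (fun n => g n - b n) =O[atTop] e) (ha : a =O[atTop] fun _ => (1 : ℝ))
    (hg1 : g =O[atTop] fun _ => (1 : ℝ)) : (fun n => f n * g n - a n * b n) =O[atTop] e := by
  have h1 := hf.mul hg1
  have h2 := ha.mul hg
  simp only [mul_one, one_mul] at h1 h2
  exact (h1.add h2).congr_left fun n => by ring

/-- The quotient of the main terms at two arguments `V ≤ U` with `U ^ 2 - V ^ 2 = c ^ 2`. -/
theorem mainTerm_div {U V c : ℝ} (hV : 1 ≤ V) (hVU : V ≤ U) (hUV : U ^ 2 - V ^ 2 = c ^ 2) :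
    mainTerm V / mainTerm U =
      (U ^ 2 / V ^ 2) * ((1 - 1 / (2 * V)) / (1 - 1 / (2 * U))) *
        Real.exp (-(2 * c ^ 2 / (U + V))) := by
  have hU : 1 ≤ U := hV.trans hVU
  have h1 : Real.exp (2 * V) = Real.exp (-(2 * c ^ 2 / (U + V))) * Real.exp (2 * U) := by
    rw [← Real.exp_add, ← hUV]
    congr 1
    have : U + V ≠ 0 := by positivity
    field_simp
    ring
  have h2 : 1 - 1 / (2 * U) ≠ 0 := by
    have : 1 / (2 * U) ≤ 1 / 2 := by
      rw [div_le_div_iff₀ (by linarith) two_pos]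
      linarith
    linarith
  rw [mainTerm, mainTerm, h1]
  have hU0 : U ≠ 0 := by positivity
  have hV0 : V ≠ 0 := by positivity
  have := (Real.exp_pos (2 * U)).ne'
  generalize 1 - 1 / (2 * U) = a at *
  field_simp

/-- The saddle point parameter `π √((n - a) / 6)`; the main term for `p(n)` has `a = 1 / 24`, the
one for `p(n - 1)` has `a = 25 / 24`. -/
noncomputable def saddleParam (a : ℝ) (n : ℕ) : ℝ := Real.sqrt (Real.pi ^ 2 / 6 * (n - a))

theorem saddleParam_sq {a : ℝ} {n : ℕ} (h : a ≤ n) :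
    saddleParam a n ^ 2 = Real.pi ^ 2 / 6 * (n - a) :=
  Real.sq_sqrt (mul_nonneg (by positivity) (by linarith))

theorem sqrt_le_saddleParam {a : ℝ} (ha : a ≤ 25 / 24) {n : ℕ} (hn : 3 ≤ n) :
    Real.sqrt n ≤ saddleParam a n := by
  refine Real.sqrt_le_sqrt ?_
  have := pi_sq_div_six_bounds.1
  have hn' : (3 : ℝ) ≤ n := by exact_mod_cast hn
  nlinarith

theorem sq_eq_pi_sq_div_six {c : ℝ} (hc : c = Real.pi / Real.sqrt 6) : c ^ 2 = Real.pi ^ 2 / 6 := by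
  rw [hc, div_pow, Real.sq_sqrt (by norm_num)]

theorem isBigO_sq_ratio :
    (fun n : ℕ => saddleParam (1 / 24) n ^ 2 / saddleParam (25 / 24) n ^ 2 -
      (1 + 1 / Real.sqrt n ^ 2)) =O[atTop] fun n : ℕ => 1 / Real.sqrt n ^ 3 := by
  refine IsBigO.of_bound 3 ?_
  filter_upwards [eventually_ge_atTop 100] with n hn
  have hn' : (100 : ℝ) ≤ n := by exact_mod_cast hn
  have hs : Real.sqrt n ^ 2 = n := Real.sq_sqrt (by linarith)
  have hA := pi_sq_div_six_bounds.1
  rw [saddleParam_sq (by linarith), saddleParam_sq (by linarith)]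
  set s := Real.sqrt n with hsdef
  have hs10 : 10 ≤ s := by
    rw [hsdef, Real.le_sqrt' (by norm_num)]
    linarith
  rw [← hs] at hn' ⊢
  have h1 : Real.pi ^ 2 / 6 * (s ^ 2 - 1 / 24) / (Real.pi ^ 2 / 6 * (s ^ 2 - 25 / 24)) -
      (1 + 1 / s ^ 2) = 25 / (s ^ 2 * (24 * s ^ 2 - 25)) := by
    have h0 : Real.pi ^ 2 / 6 ≠ 0 := by linarith
    obtain ⟨d, hd⟩ : ∃ d, s ^ 2 = d + 25 / 24 := ⟨s ^ 2 - 25 / 24, by ring⟩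
    have hd0 : d ≠ 0 := by linarith
    have hd1 : d + 25 / 24 ≠ 0 := by linarith
    rw [mul_div_mul_left _ _ h0, hd, add_sub_cancel_right,
      show 24 * (d + 25 / 24) - 25 = 24 * d by ring, show d + 25 / 24 - 1 / 24 = d + 1 by ring,
      add_div, div_self hd0, add_sub_add_left_eq_sub, div_sub_div _ _ hd0 hd1,
      div_eq_div_iff (mul_ne_zero hd0 hd1) (by positivity)]
    ring
  have h24 : 0 < 24 * s ^ 2 - 25 := by linarith
  rw [h1, Real.norm_of_nonneg (by positivity), Real.norm_of_nonneg (by positivity), mul_one_div,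
    div_le_div_iff₀ (by positivity) (by positivity)]
  have h3 : 25 * s ≤ 3 * (24 * s ^ 2 - 25) := by nlinarith
  nlinarith [mul_le_mul_of_nonneg_left h3 (by positivity : 0 ≤ s ^ 2)]

theorem isBigO_linear_ratio :
    (fun n : ℕ => (1 - 1 / (2 * saddleParam (25 / 24) n)) / (1 - 1 / (2 * saddleParam (1 / 24) n)) -
      1) =O[atTop] fun n : ℕ => 1 / Real.sqrt n ^ 3 := by
  refine IsBigO.of_bound 1 ?_
  filter_upwards [eventually_ge_atTop 100] with n hn
  have hn' : (100 : ℝ) ≤ n := by exact_mod_cast hn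
  have hA := pi_sq_div_six_bounds.2
  have hU := saddleParam_sq (a := 1 / 24) (n := n) (by linarith)
  have hV := saddleParam_sq (a := 25 / 24) (n := n) (by linarith)
  have hsU := sqrt_le_saddleParam (a := 1 / 24) (by norm_num) (by omega : 3 ≤ n)
  have hsV := sqrt_le_saddleParam (a := 25 / 24) le_rfl (by omega : 3 ≤ n)
  have hs10 : 10 ≤ Real.sqrt n := by
    rw [Real.le_sqrt' (by norm_num)]
    linarith
  set U := saddleParam (1 / 24) n
  set V := saddleParam (25 / 24) n
  set s := Real.sqrt n
  have hd : (U - V) * (U + V) = Real.pi ^ 2 / 6 := by linear_combination hU - hV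
  have hVU : 0 < U - V := by
    by_contra! h
    nlinarith [pi_sq_div_six_bounds.1]
  have hd2 : (U - V) * (2 * s) ≤ 2 := by nlinarith
  have hs0 : 0 < s := by linarith
  have hV0 : 0 < V := by linarith
  have hden : 0 < 2 * U - 1 := by linarith
  have h1 : (1 - 1 / (2 * V)) / (1 - 1 / (2 * U)) - 1 = -((U - V) / (V * (2 * U - 1))) := by
    have hU0 : U ≠ 0 := by linarith
    have h2 : 1 - 1 / (2 * U) = (2 * U - 1) / (2 * U) := by field_simp
    rw [h2]
    field_simp
    ring
  rw [h1, norm_neg, one_mul, Real.norm_of_nonneg (by positivity),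
    Real.norm_of_nonneg (by positivity), div_le_div_iff₀ (by positivity) (by positivity), one_mul]
  have h3 : (U - V) * s ≤ 1 := by linarith
  have h4 : s * s ≤ V * (2 * U - 1) := by
    apply mul_le_mul hsV (by linarith) (by linarith) (by linarith)
  calc (U - V) * s ^ 3 = ((U - V) * s) * (s * s) := by ring
    _ ≤ 1 * (V * (2 * U - 1)) := by gcongr
    _ = _ := one_mul _

theorem isBigO_exponent {c : ℝ} (hc : c = Real.pi / Real.sqrt 6) :
    (fun n : ℕ => 2 * c ^ 2 / (saddleParam (1 / 24) n + saddleParam (25 / 24) n) -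
      c / Real.sqrt n) =O[atTop] fun n : ℕ => 1 / Real.sqrt n ^ 3 := by
  have hc2 := sq_eq_pi_sq_div_six hc
  have hc0 : 0 < c := by rw [hc]; have := Real.pi_pos; positivity
  obtain ⟨hA1, hA2⟩ := pi_sq_div_six_bounds
  refine IsBigO.of_bound 4 ?_
  filter_upwards [eventually_ge_atTop 100] with n hn
  have hn' : (100 : ℝ) ≤ n := by exact_mod_cast hn
  have hs2 : Real.sqrt n ^ 2 = n := Real.sq_sqrt (by linarith)
  have hU := saddleParam_sq (a := 1 / 24) (n := n) (by linarith)
  have hV := saddleParam_sq (a := 25 / 24) (n := n) (by linarith)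
  have hsU := sqrt_le_saddleParam (a := 1 / 24) (by norm_num) (by omega : 3 ≤ n)
  have hsV := sqrt_le_saddleParam (a := 25 / 24) le_rfl (by omega : 3 ≤ n)
  have hs10 : 10 ≤ Real.sqrt n := by
    rw [Real.le_sqrt' (by norm_num)]
    linarith
  set U := saddleParam (1 / 24) n
  set V := saddleParam (25 / 24) n
  set s := Real.sqrt n
  rw [← hs2, ← hc2] at hU hV
  rw [← hc2] at hA1 hA2
  have hc1 : 1 ≤ c := by nlinarith
  have hc13 : c ≤ 1.3 := by nlinarith
  have hdU : (c * s - U) * (c * s + U) = c ^ 2 / 24 := by linear_combination -hU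
  have hdV : (c * s - V) * (c * s + V) = 25 * c ^ 2 / 24 := by linear_combination -hV
  have hs0 : 0 < s := by linarith
  have hU0 : 0 < U := by linarith
  have hV0 : 0 < V := by linarith
  have hUlow : 0 ≤ c * s - U := by
    by_contra! h
    have := mul_neg_of_neg_of_pos h (by positivity : 0 < c * s + U)
    nlinarith
  have hVlow : 0 ≤ c * s - V := by
    by_contra! h
    have := mul_neg_of_neg_of_pos h (by positivity : 0 < c * s + V)
    nlinarith
  have hbU : (c * s - U) * s ≤ 1 := by nlinarith
  have hbV : (c * s - V) * s ≤ 1 := by nlinarith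
  have h1 : 2 * c ^ 2 / (U + V) - c / s =
      c * ((c * s - U) + (c * s - V)) / ((U + V) * s) := by
    have : U + V ≠ 0 := by linarith
    have : s ≠ 0 := by linarith
    field_simp
    ring
  rw [h1, Real.norm_of_nonneg (by positivity), Real.norm_of_nonneg (by positivity), mul_one_div,
    div_le_div_iff₀ (by positivity) (by positivity)]
  calc c * ((c * s - U) + (c * s - V)) * s ^ 3
      = c * ((c * s - U) * s + (c * s - V) * s) * (s * s) := by ring
    _ ≤ 1.3 * (1 + 1) * ((U + V) * s) := by
        have : s ≤ U + V := by linarith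
        gcongr
    _ ≤ 4 * ((U + V) * s) := by
        gcongr
        norm_num

/-- Second order Taylor expansion of `exp (-d n)` when `d n = c / √n + O(n ^ (-3/2))`. -/
theorem isBigO_exp_neg {c : ℝ} {d : ℕ → ℝ}
    (hd : (fun n => d n - c / Real.sqrt n) =O[atTop] fun n : ℕ => 1 / Real.sqrt n ^ 3) :
    (fun n => Real.exp (-d n) - (1 - c / Real.sqrt n + c ^ 2 / 2 / Real.sqrt n ^ 2)) =O[atTop]
      fun n : ℕ => 1 / Real.sqrt n ^ 3 := by
  have hy := tendsto_one_div_sqrt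
  have hy1 : (fun n : ℕ => 1 / Real.sqrt n) =O[atTop] fun _ => (1 : ℝ) := hy.isBigO_one ℝ
  have he : (fun n : ℕ => 1 / Real.sqrt n ^ 3) =O[atTop] fun n : ℕ => 1 / Real.sqrt n := by
    have := (hy1.mul hy1).mul (isBigO_refl (fun n : ℕ => 1 / Real.sqrt n) atTop)
    simp only [one_mul] at this
    exact this.congr_left fun n => by rw [div_mul_div_comm, div_mul_div_comm]; ring_nf
  have hcy : (fun n : ℕ => c / Real.sqrt n) =O[atTop] fun n : ℕ => 1 / Real.sqrt n := by
    refine ((isBigO_refl (fun n : ℕ => 1 / Real.sqrt n) atTop).const_mul_left c).congr_left ?_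
    intro n
    ring
  have hdy : d =O[atTop] fun n : ℕ => 1 / Real.sqrt n :=
    ((hd.trans he).add hcy).congr_left fun n => by ring
  have hd0 : Tendsto (fun n => -d n) atTop (nhds 0) := by
    simpa using (hdy.trans_tendsto hy).neg
  have hexp : (fun n => Real.exp (-d n) - (1 + -d n + (-d n) ^ 2 / 2)) =O[atTop]
      fun n : ℕ => 1 / Real.sqrt n ^ 3 := by
    have h1 := (Real.exp_sub_sum_range_isBigO_pow 3).comp_tendsto hd0
    have h2 : (fun n => (-d n) ^ 3) =O[atTop] fun n : ℕ => (1 / Real.sqrt n) ^ 3 :=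
      hdy.neg_left.pow 3
    refine (h1.trans h2).congr (fun n => ?_) fun n => by rw [div_pow, one_pow]
    simp [Finset.sum_range_succ, Nat.factorial]
  have hsq : (fun n => d n * d n - c / Real.sqrt n * (c / Real.sqrt n)) =O[atTop]
      fun n : ℕ => 1 / Real.sqrt n ^ 3 :=
    isBigO_mul_sub_mul hd hd (hcy.trans hy1) (hdy.trans hy1)
  refine ((hexp.sub hd).add (hsq.const_mul_left (1 / 2))).congr_left fun n => ?_
  ring

theorem isBigO_mainTerm_ratio {c : ℝ} (hc : c = Real.pi / Real.sqrt 6) :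
    (fun n : ℕ => mainTerm (saddleParam (25 / 24) n) / mainTerm (saddleParam (1 / 24) n) -
      (1 - c / Real.sqrt n + (1 + c ^ 2 / 2) / n)) =O[atTop]
        fun n : ℕ => 1 / Real.sqrt n ^ 3 := by
  have hy1 : (fun n : ℕ => 1 / Real.sqrt n) =O[atTop] fun _ => (1 : ℝ) :=
    tendsto_one_div_sqrt.isBigO_one ℝ
  have hone : (fun _ : ℕ => (1 : ℝ)) =O[atTop] fun _ => (1 : ℝ) := isBigO_refl _ _
  have hy2 : (fun n : ℕ => 1 / Real.sqrt n ^ 2) =O[atTop] fun _ => (1 : ℝ) := by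
    have := hy1.mul hy1
    simp only [one_mul] at this
    exact this.congr_left fun n => by rw [div_mul_div_comm]; ring_nf
  have hy3 : (fun n : ℕ => 1 / Real.sqrt n ^ 3) =O[atTop] fun _ => (1 : ℝ) := by
    have := hy2.mul hy1
    simp only [one_mul] at this
    exact this.congr_left fun n => by rw [div_mul_div_comm]; ring_nf
  have hy23 : (fun n : ℕ => 1 + 1 / Real.sqrt n ^ 2) =O[atTop] fun _ => (1 : ℝ) := hone.add hy2
  have h2 := isBigO_linear_ratio
  have h3 := isBigO_exp_neg (isBigO_exponent hc)
  have hlin1 := ((h2.trans hy3).add hone).congr_left fun n => sub_add_cancel _ _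
  have hpoly : (fun n : ℕ => 1 - c / Real.sqrt n + c ^ 2 / 2 / Real.sqrt n ^ 2) =O[atTop]
      fun _ => (1 : ℝ) :=
    ((hone.sub (hy1.const_mul_left c)).add (hy2.const_mul_left (c ^ 2 / 2))).congr_left
      fun n => by ring
  have hexp1 := ((h3.trans hy3).add hpoly).congr_left fun n => sub_add_cancel _ _
  have h12 := isBigO_mul_sub_mul isBigO_sq_ratio h2 hy23 hlin1
  have h123 := isBigO_mul_sub_mul h12 h3 (hy23.mul hone |>.trans (by simpa using hone)) hexp1
  have hcube : (fun n : ℕ => (-c + c ^ 2 / 2 * (1 / Real.sqrt n)) * (1 / Real.sqrt n ^ 3)) =O[atTop]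
      fun n : ℕ => 1 / Real.sqrt n ^ 3 := by
    have h4 : (fun n : ℕ => -c + c ^ 2 / 2 * (1 / Real.sqrt n)) =O[atTop] fun _ => (1 : ℝ) :=
      (isBigO_const_const _ one_ne_zero _).add (hy1.const_mul_left _)
    have := h4.mul (isBigO_refl (fun n : ℕ => 1 / Real.sqrt n ^ 3) atTop)
    simpa only [one_mul] using this
  refine (h123.add hcube).congr' ?_ EventuallyEq.rfl
  filter_upwards [eventually_ge_atTop 100] with n hn
  have hn' : (100 : ℝ) ≤ n := by exact_mod_cast hn
  have hs2 : Real.sqrt n ^ 2 = n := Real.sq_sqrt (by linarith)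
  have hsV := sqrt_le_saddleParam (a := 25 / 24) le_rfl (by omega : 3 ≤ n)
  have hs10 : 10 ≤ Real.sqrt n := by
    rw [Real.le_sqrt' (by norm_num)]
    linarith
  have hVU : saddleParam (25 / 24) n ≤ saddleParam (1 / 24) n := by
    refine Real.sqrt_le_sqrt ?_
    gcongr
    norm_num
  have hd : saddleParam (1 / 24) n ^ 2 - saddleParam (25 / 24) n ^ 2 = c ^ 2 := by
    rw [saddleParam_sq (by linarith), saddleParam_sq (by linarith), sq_eq_pi_sq_div_six hc]
    ring
  rw [mainTerm_div (by linarith) hVU hd, ← hs2]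
  have hs0 : Real.sqrt n ≠ 0 := by linarith
  rw [Real.sqrt_sq (Real.sqrt_nonneg _)]
  generalize Real.sqrt n = s at *
  field_simp
  ring

theorem isBigO_numPartitions_ratio {c : ℝ} (hc : c = Real.pi / Real.sqrt 6) :
    (fun n : ℕ => (numPartitions (n - 1) : ℝ) / numPartitions n -
      (1 - c / Real.sqrt n + (1 + c ^ 2 / 2) / n)) =O[atTop]
        fun n : ℕ => 1 / Real.sqrt n ^ 3 := by
  obtain ⟨K, hK, h⟩ := exists_abs_numPartitions_div_sub_one_le
  have hκ := mainConst_pos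
  let α : ℕ → ℝ := fun n => (numPartitions n : ℝ) / (mainConst * mainTerm (saddleParam (1 / 24) n))
  let β : ℕ → ℝ := fun n =>
    (numPartitions (n - 1) : ℝ) / (mainConst * mainTerm (saddleParam (25 / 24) n))
  have hy := tendsto_one_div_sqrt
  have hy3 : Tendsto (fun n : ℕ => 1 / Real.sqrt n ^ 3) atTop (nhds 0) := by
    simpa using hy.pow 3
  have hα : (fun n => α n - 1) =O[atTop] fun n : ℕ => 1 / Real.sqrt n ^ 3 := by
    refine IsBigO.of_bound K ?_
    filter_upwards [eventually_ge_atTop 100] with n hn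
    have hn' : (100 : ℝ) ≤ n := by exact_mod_cast hn
    have hs10 : 10 ≤ Real.sqrt n := by
      rw [Real.le_sqrt' (by norm_num)]
      linarith
    have hle := sqrt_le_saddleParam (a := 1 / 24) (by norm_num) (by omega : 3 ≤ n)
    refine (h n _ (by linarith) (saddleParam_sq (by linarith))).trans ?_
    rw [Real.norm_of_nonneg (by positivity), mul_one_div]
    gcongr
  have hβ : (fun n => β n - 1) =O[atTop] fun n : ℕ => 1 / Real.sqrt n ^ 3 := by
    refine IsBigO.of_bound K ?_
    filter_upwards [eventually_ge_atTop 100] with n hn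
    have hn' : (100 : ℝ) ≤ n := by exact_mod_cast hn
    have hs10 : 10 ≤ Real.sqrt n := by
      rw [Real.le_sqrt' (by norm_num)]
      linarith
    have hle := sqrt_le_saddleParam (a := 25 / 24) le_rfl (by omega : 3 ≤ n)
    have hsq : saddleParam (25 / 24) n ^ 2 = Real.pi ^ 2 / 6 * ((n - 1 : ℕ) - 1 / 24) := by
      rw [saddleParam_sq (by linarith), Nat.cast_sub (by omega)]
      push_cast
      ring
    refine (h (n - 1) _ (by linarith) hsq).trans ?_
    rw [Real.norm_of_nonneg (by positivity), mul_one_div]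
    gcongr
  have hα1 : Tendsto α atTop (nhds 1) := by
    simpa using (hα.trans_tendsto hy3).add_const 1
  have hquot : (fun n => β n / α n - 1) =O[atTop] fun n : ℕ => 1 / Real.sqrt n ^ 3 := by
    have h1 := (hβ.sub hα).mul ((hα1.inv₀ one_ne_zero).isBigO_one ℝ)
    simp only [mul_one] at h1
    refine h1.congr' ?_ EventuallyEq.rfl
    filter_upwards [hα1.eventually_ne one_ne_zero] with n hn
    field_simp
    ring
  have hpoly : (fun n : ℕ => 1 - c / Real.sqrt n + (1 + c ^ 2 / 2) / n) =O[atTop]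
      fun _ => (1 : ℝ) := by
    have h1 : Tendsto (fun n : ℕ => 1 - c * (1 / Real.sqrt n) + (1 + c ^ 2 / 2) * (1 / (n : ℝ)))
        atTop (nhds (1 - c * 0 + (1 + c ^ 2 / 2) * 0)) :=
      (tendsto_const_nhds.sub (hy.const_mul c)).add
        (tendsto_one_div_atTop_nhds_zero_nat.const_mul _)
    exact (h1.isBigO_one ℝ).congr_left fun n => by ring
  have hquot1 := ((hquot.trans (hy3.isBigO_one ℝ)).add
    (isBigO_refl (fun _ : ℕ => (1 : ℝ)) atTop)).congr_left fun n => sub_add_cancel _ _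
  refine (isBigO_mul_sub_mul (isBigO_mainTerm_ratio hc) hquot hpoly hquot1).congr' ?_
    EventuallyEq.rfl
  filter_upwards [eventually_ge_atTop 100] with n hn
  have hn' : (100 : ℝ) ≤ n := by exact_mod_cast hn
  have hs10 : 10 ≤ Real.sqrt n := by
    rw [Real.le_sqrt' (by norm_num)]
    linarith
  have hU := mainTerm_pos ((by linarith : 1 ≤ Real.sqrt n).trans
    (sqrt_le_saddleParam (a := 1 / 24) (by norm_num) (by omega : 3 ≤ n)))
  have hV := mainTerm_pos ((by linarith : 1 ≤ Real.sqrt n).trans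
    (sqrt_le_saddleParam (a := 25 / 24) le_rfl (by omega : 3 ≤ n)))
  rw [mul_one]
  congr 1
  simp only [α, β]
  field_simp

end RandomPartition

theorem theorem1 :
    (∀ n : ℕ, 1 ≤ n →
      (RandomPartition.uniformMeasure n).real {lam | RandomPartition.largestPartMult lam = 1} =
        (RandomPartition.numPartitions (n - 1) : ℝ) / (RandomPartition.numPartitions n : ℝ)) ∧
    ∀ c : ℝ, c = Real.pi / Real.sqrt 6 →
      (fun n : ℕ =>
        (RandomPartition.uniformMeasure n).real {lam | RandomPartition.largestPartMult lam = 1} -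
          (1 - c / Real.sqrt (n : ℝ) + (1 + c ^ 2 / 2) / (n : ℝ)))
        =O[atTop] (fun n : ℕ => (n : ℝ) ^ (-(3 / 2) : ℝ)) := by
  refine ⟨RandomPartition.uniformMeasure_largestPartMult_eq_one, fun c hc => ?_⟩
  refine (RandomPartition.isBigO_numPartitions_ratio hc).congr' ?_ ?_
  · filter_upwards [eventually_ge_atTop 1] with n hn
    rw [RandomPartition.uniformMeasure_largestPartMult_eq_one n hn]
  · filter_upwards with n
    rw [Real.rpow_neg n.cast_nonneg, Real.sqrt_eq_rpow, ← Real.rpow_natCast,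
      ← Real.rpow_mul n.cast_nonneg, one_div]
    norm_num
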